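/- Let $n\ge 1$, let $\mathbb{T}^n=\mathbb{R}^n/\mathbb{Z}^n$ carry the quotient (Euclidean) metric and Lebesgue measure, and let $W:\mathbb{R}^n\to\mathbb{R}$ be a convex function with $W\in C^2(\mathbb{R}^n\setminus\{0\})$, $W^2$ strictly convex, and, for some $\lambda_0>0$, $W(ap)=aW(p)\ge\lambda_0 a|p|$ for all $p\in\mathbb{R}^n$ and $a\ge 0$. On the Hilbert space $L^2(\mathbb{T}^n)$ consider the anisotropic total variation energy $$E(\psi)=\begin{cases}\int_{\mathbb{T}^n}W(\nabla\psi) & \text{if }\psi\in L^2(\mathbb{T}^n)\cap BV(\mathbb{T}^n),\\ +\infty & \text{if }\psi\in L^2(\mathbb{T}^n)\setminus BV(\mathbb{T}^n),\end{cases}$$ where for $\psi\in BV(\mathbb{T}^n)$, with $D\psi=\nabla\psi\,dx+D^s\psi$ the Lebesgue decomposition of its distributional gradient, $\int_{\mathbb{T}^n}W(\nabla\psi)$ stands for $\int W(\nabla\psi)\,dx+\int W\!\left(\frac{D^s\psi}{|D^s\psi|}\right)d|D^s\psi|$. Its subdifferential at $\psi$ is $$\partial E(\psi)=\{v\in L^2(\mathbb{T}^n):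 E(\psi+h)-E(\psi)\ge\langle h,v\rangle_{L^2}\ \text{for all } h\in L^2(\mathbb{T}^n)\}$$ if $E(\psi)<\infty$, and it is empty if $E(\psi)=\infty$; let $\operatorname{dom}(\partial E)=\{\psi\in L^2(\mathbb{T}^n):\partial E(\psi)\neq\emptyset\}$. Let $(G_-,G_+)$ be a smooth pair, that is, $G_-$ and $G_+$ are disjoint open subsets of $\mathbb{T}^n$ with $C^\infty$ boundaries (each set lying locally on one side of its boundary) and with $\operatorname{dist}(G_-,G_+)>0$; either set may be empty, in which case the distance is $+\infty$. Then $(G_-,G_+)$ has a support function in $\operatorname{dom}(\partial E)$: there exists a Lipschitz function $\psi:\mathbb{T}^n\to\mathbb{R}$ with $\psi>0$ in $G_+$, $\psi=0$ in $(G_-\cup G_+)^c$, $\psi<0$ in $G_-$, such that $\psi\in\operatorname{dom}(\partial E)$. -/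

import Mathlib

open MeasureTheory Set
open scoped ENNReal ContDiff

noncomputable section

namespace TVFlow

/-- `ℝⁿ` with the Euclidean norm. -/
abbrev Eucl (n : ℕ) : Type := EuclideanSpace ℝ (Fin n)

/-- The lattice `ℤⁿ ⊆ ℝⁿ`, the integer combinations of the standard basis. -/
def intLattice (n : ℕ) : AddSubgroup (Eucl n) :=
  (Submodule.span ℤ (Set.range (EuclideanSpace.basisFun (Fin n) ℝ).toBasis)).toAddSubgroup

/-- The torus `𝕋ⁿ = ℝⁿ / ℤⁿ`. Mathlib equips it with the quotient topology and with the quotient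
norm `|x + ℤⁿ| = inf {|x + k| : k ∈ ℤⁿ}`, hence with the metric `dist x y = |x - y|`. -/
abbrev Torus (n : ℕ) : Type := Eucl n ⧸ intLattice n

/-- Lebesgue measure on the torus: the image of Lebesgue measure on the unit cube `[0,1)ⁿ`. -/
def torusMeasure (n : ℕ) : Measure (Torus n) :=
  (volume.restrict {y : Eucl n | ∀ i, y i ∈ Ico (0 : ℝ) 1}).map (QuotientAddGroup.mk : Eucl n → Torus n)

/-- The real Hilbert space `L²(𝕋ⁿ)`. -/
abbrev TorusL2 (n : ℕ) : Type := Lp ℝ 2 (torusMeasure n)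

/-- `φ ∈ C^∞(𝕋ⁿ)`: the `ℤⁿ`-periodic lift of `φ` to `ℝⁿ` is smooth. -/
def IsSmooth {n : ℕ} (φ : Torus n → ℝ) : Prop :=
  ContDiff ℝ ∞ (fun y : Eucl n => φ (y : Torus n))

/-- The classical gradient of a function on the torus. -/
def torusGradient {n : ℕ} (φ : Torus n → ℝ) (x : Torus n) : Eucl n :=
  gradient (fun y : Eucl n => φ (x + (y : Torus n))) 0

/-- The standing assumptions on the anisotropy `W`. -/
structure IsAnisotropy {n : ℕ} (W : Eucl n → ℝ) : Prop where
  contDiffOn : ContDiffOn ℝ 2 W {0}ᶜ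
  strictConvexOn_sq : StrictConvexOn ℝ univ (fun p => W p ^ 2)
  convexOn : ConvexOn ℝ univ W
  homogeneous : ∀ (a : ℝ) (p : Eucl n), 0 ≤ a → W (a • p) = a * W p
  coercive : ∃ lam : ℝ, 0 < lam ∧ ∀ p : Eucl n, lam * ‖p‖ ≤ W p

/-- The subdifferential of an extended real valued convex function `φ : H → (-∞, +∞]` on a real
Hilbert space; it is empty at the points where `φ = +∞`. -/
def subdifferential {H : Type*} [NormedAddCommGroup H] [InnerProductSpace ℝ H]
    (φ : H → EReal) (x : H) : Set H :=
  {v | φ x ≠ ⊤ ∧ ∀ h : H, φ x + ((inner ℝ h v : ℝ) : EReal) ≤ φ (x + h)}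

/-- `dom(∂φ)`. -/
def domSubdifferential {H : Type*} [NormedAddCommGroup H] [InnerProductSpace ℝ H]
    (φ : H → EReal) : Set H :=
  {x | (subdifferential φ x).Nonempty}

/-- `D` is the gradient of `u` in the sense of distributions, and it is an `ℝⁿ`-valued Borel
measure of finite total variation: `∫ φ dD = -∫ u ∇φ dx` for all `φ ∈ C^∞(𝕋ⁿ)`.
A function `u ∈ L²(𝕋ⁿ)` belongs to `BV(𝕋ⁿ)` if and only if there is such a `D`,
and `D` is then unique. -/
structure IsGradientMeasure {n : ℕ} (u : Torus n → ℝ)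
    (D : VectorMeasure (Torus n) (Eucl n)) : Prop where
  finite_variation : D.variation univ < ⊤
  integral_eq : ∀ φ : Torus n → ℝ, IsSmooth φ →
    D.integral φ (ContinuousLinearMap.lsmul ℝ ℝ) =
      -∫ x, u x • torusGradient φ x ∂(torusMeasure n)

/-- The Lebesgue decomposition `D = g dx + S` of a vector measure, `S` being singular with respect
to Lebesgue measure, together with the density `σ = S / |S|` of `S` with respect to its total
variation. These `g`, `S`, `σ` are unique up to null sets. -/
structure IsLebesguePolar {n : ℕ} (D : VectorMeasure (Torus n) (Eucl n))
    (g : Torus n → Eucl n) (S : VectorMeasure (Torus n) (Eucl n)) (σ : Torus n → Eucl n) :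
    Prop where
  integrable_density : Integrable g (torusMeasure n)
  decomposition : D = (torusMeasure n).withDensityᵥ g + S
  singular : S.variation ⟂ₘ torusMeasure n
  integrable_polar : Integrable σ S.variation
  polar : S = S.variation.withDensityᵥ σ

/-- The total mass `∫ W(g) dx + ∫ W(S / |S|) d|S|` of the measure `W(D)`, where `D = g dx + S` is
the Lebesgue decomposition of `D`. As `g`, `S` and `S / |S|` are determined by `D`, the infimum is
over one and the same value. -/
def anisotropicMass {n : ℕ} (W : Eucl n → ℝ) (D : VectorMeasure (Torus n) (Eucl n)) : ℝ≥0∞ :=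
  ⨅ (g : Torus n → Eucl n) (S : VectorMeasure (Torus n) (Eucl n)) (σ : Torus n → Eucl n)
    (_ : IsLebesguePolar D g S σ),
    ∫⁻ x, ENNReal.ofReal (W (g x)) ∂(torusMeasure n) +
      ∫⁻ x, ENNReal.ofReal (W (σ x)) ∂S.variation

/-- The anisotropic total variation energy `E` on `L²(𝕋ⁿ)`: the total mass of `W(Du)` if
`u ∈ BV(𝕋ⁿ)` (the infimum is then over the single measure `D = Du`), and `+∞` otherwise
(the infimum of the empty family). -/
def energy {n : ℕ} (W : Eucl n → ℝ) (u : TorusL2 n) : EReal :=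
  ((⨅ (D : VectorMeasure (Torus n) (Eucl n)) (_ : IsGradientMeasure (u : Torus n → ℝ) D),
    anisotropicMass W D : ℝ≥0∞) : EReal)

/-- The open set `A` has a `C^∞` boundary: near each of its boundary points, `A` is the sublevel
set `{f < 0}` of a smooth function `f` whose differential does not vanish there. -/
def HasSmoothBoundary {n : ℕ} (A : Set (Torus n)) : Prop :=
  ∀ x ∈ frontier A, ∃ r : ℝ, 0 < r ∧ ∃ f : Eucl n → ℝ,
    ContDiffOn ℝ ∞ f (Metric.ball 0 r) ∧ fderiv ℝ f 0 ≠ 0 ∧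
      ∀ y ∈ Metric.ball (0 : Eucl n) r, (x + (y : Torus n) ∈ A ↔ f y < 0)

/-- `(A₋, A₊)` is a smooth pair: two disjoint open sets with smooth boundaries and at a positive
distance (which is `+∞` if one of the sets is empty). -/
structure IsSmoothPair {n : ℕ} (Aminus Aplus : Set (Torus n)) : Prop where
  disjoint : Disjoint Aminus Aplus
  isOpen_minus : IsOpen Aminus
  isOpen_plus : IsOpen Aplus
  dist_pos : 0 < ⨅ (x ∈ Aminus) (y ∈ Aplus), edist x y
  smooth_minus : HasSmoothBoundary Aminus
  smooth_plus : HasSmoothBoundary Aplus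

/-- `ψ ∈ Lip(𝕋ⁿ)` is a support function of the pair `(A₋, A₊)`. -/
structure IsSupportFunction {n : ℕ} (ψ : Torus n → ℝ) (Aminus Aplus : Set (Torus n)) :
    Prop where
  lipschitz : ∃ K, LipschitzWith K ψ
  pos : ∀ x ∈ Aplus, 0 < ψ x
  zero : ∀ x ∈ (Aminus ∪ Aplus)ᶜ, ψ x = 0
  neg : ∀ x ∈ Aminus, ψ x < 0

end TVFlow

end

/-! The proof is a calibration argument. Suppose a periodic `C¹` field `z` satisfies `⟪z, p⟫ ≤ W p`
for all `p` (values in the Wulff shape) and `⟪z, ∇ψ⟫ = W (∇ψ)`. Integration by parts shows that `v =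
-div z` satisfies `⟪u, v⟫ ≤ E(u)` for every `u` in `L²`, with equality at the smooth function `ψ`;
subtracting gives `v ∈ ∂E(ψ)`. This is `le_energy`, `energy_le` and
`mem_domSubdifferential_of_calibration`.

Such a `z` comes from a defining function. As `W` is convex and positively homogeneous, `∇W(q)` with
`q ≠ 0` lies in the Wulff shape and calibrates every nonnegative multiple of `q`. Hence if `ψ` is a
nondecreasing profile of a function `P`, the field `∇W(∇P)` calibrates `∇ψ` even where `∇ψ`
vanishes; only `∇P ≠ 0` is needed, and only where the profile varies. Away from there the field may
be cut off, the Wulff shape being convex and containing `0`.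

It remains to find smooth `P`, `Q` with `G₊ = {P > 0}`, `G₋ = {Q < 0}` and no critical points in the
bands `|P| < 1`, `|Q| < 1`. Local defining functions of the right sign add up without creating
critical zeros (`regularSet_subset_add`), compactness thickens the zero set to a band, and scaling
normalizes its width. Positive distance makes the closures of `G₋` and `G₊` disjoint, so the two
bands can be kept apart and the two constructions superposed. -/

noncomputable section

namespace TVFlow

open Filter Topology

variable {n : ℕ}

/-! ### Periodic functions, compactness of the torus, and integration over the unit cube. -/

section Periodic

variable {X : Type*}

/-- Periodicity with respect to the integer lattice. -/
def IsLatticePeriodic (f : Eucl n → X) : Prop :=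
  ∀ y, ∀ k ∈ intLattice n, f (y + k) = f y

/-- The function on the torus with a given periodic lift. -/
def descend (f : Eucl n → X) (x : Torus n) : X := f (Quotient.out x)

lemma descend_mk {f : Eucl n → X} (hf : IsLatticePeriodic f) (y : Eucl n) :
    descend f (y : Torus n) = f y := by
  have h : ((Quotient.out (y : Torus n) : Eucl n) : Torus n) = y := Quotient.out_eq _
  rw [eq_comm, QuotientAddGroup.eq] at h
  have := hf y _ h
  rwa [add_neg_cancel_left] at this

lemma isLatticePeriodic_lift (φ : Torus n → X) :
    IsLatticePeriodic (fun y : Eucl n => φ (y : Torus n)) := by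
  intro y k hk
  have : ((y + k : Eucl n) : Torus n) = y := by
    rw [eq_comm, QuotientAddGroup.eq]
    simpa using hk
  simp only [this]

lemma IsLatticePeriodic.comp {Y : Type*} {f : Eucl n → X} (hf : IsLatticePeriodic f) (g : X → Y) :
    IsLatticePeriodic (fun y => g (f y)) := fun y k hk => congrArg g (hf y k hk)

lemma continuous_torusMk : Continuous (fun y : Eucl n => (y : Torus n)) := continuous_quot_mk

lemma continuous_descend [TopologicalSpace X] {f : Eucl n → X} (hf : IsLatticePeriodic f)
    (hc : Continuous f) : Continuous (descend f) := by
  refine isQuotientMap_quot_mk.continuous_iff.2 ?_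
  have : descend f ∘ (QuotientAddGroup.mk : Eucl n → Torus n) = f := funext (descend_mk hf)
  rw [← this] at hc
  exact hc

lemma IsLatticePeriodic.fderiv {F : Type*} [NormedAddCommGroup F] [NormedSpace ℝ F]
    {f : Eucl n → F} (hf : IsLatticePeriodic f) : IsLatticePeriodic (fderiv ℝ f) := by
  intro y k hk
  rw [← fderiv_comp_add_right]
  congr 1
  exact funext fun y => hf y k hk

lemma IsLatticePeriodic.gradient {f : Eucl n → ℝ} (hf : IsLatticePeriodic f) :
    IsLatticePeriodic (gradient f) := hf.fderiv.comp _

lemma torusGradient_mk (φ : Torus n → ℝ) (y : Eucl n) :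
    torusGradient φ (y : Torus n) = gradient (fun y : Eucl n => φ (y : Torus n)) y := by
  unfold torusGradient gradient
  congr 1
  have := fderiv_comp_add_left (𝕜 := ℝ) (f := fun y : Eucl n => φ (y : Torus n)) (x := 0) y
  simpa using this

instance : DiscreteTopology (intLattice n) :=
  inferInstanceAs (DiscreteTopology (Submodule.span ℤ
    (Set.range (EuclideanSpace.basisFun (Fin n) ℝ).toBasis)))

instance : Countable (intLattice n) :=
  inferInstanceAs (Countable (Submodule.span ℤ
    (Set.range (EuclideanSpace.basisFun (Fin n) ℝ).toBasis)))

instance isClosed_intLattice : IsClosed (intLattice n : Set (Eucl n)) :=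
  AddSubgroup.isClosed_of_discrete

instance : BorelSpace (Torus n) := QuotientAddGroup.borelSpace

lemma isCompact_range_of_isLatticePeriodic [TopologicalSpace X] {f : Eucl n → X}
    (hf : IsLatticePeriodic f) (hc : Continuous f) : IsCompact (Set.range f) :=
  IsZLattice.isCompact_range_of_periodic (Submodule.span ℤ
    (Set.range (EuclideanSpace.basisFun (Fin n) ℝ).toBasis)) f hc hf

instance : CompactSpace (Torus n) := by
  refine ⟨?_⟩
  have h := isCompact_range_of_isLatticePeriodic (isLatticePeriodic_lift (n := n) id)
    continuous_torusMk
  rwa [show Set.range (fun y : Eucl n => id (y : Torus n)) = univ from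
    QuotientAddGroup.mk_surjective.range_eq] at h

lemma exists_norm_le_of_isLatticePeriodic {F : Type*} [NormedAddCommGroup F]
    {f : Eucl n → F} (hf : IsLatticePeriodic f) (hc : Continuous f) : ∃ C, ∀ y, ‖f y‖ ≤ C := by
  obtain ⟨C, hC⟩ := (isCompact_range_of_isLatticePeriodic hf hc).isBounded.exists_norm_le
  exact ⟨C, fun y => hC _ ⟨y, rfl⟩⟩

/-- The function factors through the compact torus, and the quotient map is `1`-Lipschitz. -/
lemma uniformContinuous_of_isLatticePeriodic {F : Type*} [NormedAddCommGroup F]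
    {f : Eucl n → F} (hf : IsLatticePeriodic f) (hc : Continuous f) : UniformContinuous f := by
  have h1 := CompactSpace.uniformContinuous_of_continuous (continuous_descend hf hc)
  have h2 : UniformContinuous (fun y : Eucl n => (y : Torus n)) := by
    refine (LipschitzWith.of_dist_le_mul (K := 1) fun a b => ?_).uniformContinuous
    rw [dist_eq_norm, dist_eq_norm, ← QuotientAddGroup.mk_sub, NNReal.coe_one, one_mul]
    exact QuotientAddGroup.norm_mk_le_norm
  have h3 := h1.comp h2
  rwa [show descend f ∘ (fun y : Eucl n => (y : Torus n)) = f from funext (descend_mk hf)] at h3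

/-- The half-open unit cube. -/
def unitCube (n : ℕ) : Set (Eucl n) := {y | ∀ i, y i ∈ Ico (0 : ℝ) 1}

lemma unitCube_eq_fundamentalDomain :
    unitCube n = ZSpan.fundamentalDomain (EuclideanSpace.basisFun (Fin n) ℝ).toBasis := by
  ext y
  simp [unitCube, ZSpan.mem_fundamentalDomain]

lemma isAddFundamentalDomain_unitCube :
    IsAddFundamentalDomain (intLattice n) (unitCube n) (volume : Measure (Eucl n)) := by
  rw [unitCube_eq_fundamentalDomain]
  exact ZSpan.isAddFundamentalDomain' _ _

lemma isBounded_unitCube : Bornology.IsBounded (unitCube n) := by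
  rw [unitCube_eq_fundamentalDomain]
  exact ZSpan.fundamentalDomain_isBounded _

lemma torusMeasure_eq :
    torusMeasure n = (volume.restrict (unitCube n)).map (fun y : Eucl n => (y : Torus n)) := rfl

instance : IsFiniteMeasure ((volume : Measure (Eucl n)).restrict (unitCube n)) :=
  ⟨by simpa using isBounded_unitCube.measure_lt_top⟩

instance : IsFiniteMeasure (torusMeasure n) := by
  rw [torusMeasure_eq]; infer_instance

lemma exists_add_mem_unitCube (y : Eucl n) : ∃ k ∈ intLattice n, y + k ∈ unitCube n := by
  rw [unitCube_eq_fundamentalDomain]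
  obtain ⟨v, hv, -⟩ := ZSpan.exist_unique_vadd_mem_fundamentalDomain
    (EuclideanSpace.basisFun (Fin n) ℝ).toBasis y
  refine ⟨v, v.2, ?_⟩
  rw [add_comm]
  exact hv

lemma integral_torusMeasure {F : Type*} [NormedAddCommGroup F] [NormedSpace ℝ F]
    {φ : Torus n → F} (hφ : AEStronglyMeasurable φ (torusMeasure n)) :
    ∫ x, φ x ∂torusMeasure n = ∫ y in unitCube n, φ (y : Torus n) := by
  rw [torusMeasure_eq] at hφ ⊢
  exact integral_map continuous_torusMk.measurable.aemeasurable hφ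

/-- A translate of the cube is another fundamental domain of the lattice. -/
lemma integral_unitCube_add {F : Type*} [NormedAddCommGroup F] [NormedSpace ℝ F]
    {f : Eucl n → F} (hf : IsLatticePeriodic f) (v : Eucl n) :
    ∫ y in unitCube n, f (y + v) = ∫ y in unitCube n, f y := by
  have h1 := (isAddFundamentalDomain_unitCube (n := n)).vadd_of_comm v
  have h2 := (isAddFundamentalDomain_unitCube (n := n)).setIntegral_eq h1 (f := f)
    (fun g x => by
      rw [AddSubgroup.vadd_def, vadd_eq_add, add_comm]
      exact hf x g g.2)
  rw [h2]
  have h3 := (measurePreserving_add_left (volume : Measure (Eucl n)) v).setIntegral_image_emb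
    (measurableEmbedding_addLeft v) f (unitCube n)
  simp only [add_comm _ v]
  exact h3.symm

/-- The integral of the translate `f (· + v)` does not depend on `v`; differentiating it under the
integral sign at `v = 0` gives the claim. -/
lemma integral_unitCube_fderiv {F : Type*} [NormedAddCommGroup F] [NormedSpace ℝ F]
    [CompleteSpace F] {f : Eucl n → F} (hf : IsLatticePeriodic f) (hc : ContDiff ℝ 1 f) :
    ∫ y in unitCube n, fderiv ℝ f y = 0 := by
  have hcf : Continuous (fderiv ℝ f) := hc.continuous_fderiv one_ne_zero
  obtain ⟨C, hC⟩ := exists_norm_le_of_isLatticePeriodic hf.fderiv hcf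
  obtain ⟨C', hC'⟩ := exists_norm_le_of_isLatticePeriodic hf hc.continuous
  have h := hasFDerivAt_integral_of_dominated_of_fderiv_le (𝕜 := ℝ)
    (μ := volume.restrict (unitCube n)) (F := fun v y => f (y + v))
    (F' := fun v y => fderiv ℝ f (y + v)) (x₀ := (0 : Eucl n)) (s := univ) (bound := fun _ => C)
    univ_mem
    (Eventually.of_forall fun v => by
      exact (hc.continuous.comp (continuous_add_const v)).aestronglyMeasurable)
    (Integrable.of_bound (C := C')
      (hc.continuous.comp (continuous_add_const 0)).aestronglyMeasurable
      (Eventually.of_forall fun y => hC' _))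
    (hcf.comp (continuous_add_const 0)).aestronglyMeasurable
    (Eventually.of_forall fun y v _ => hC _) (integrable_const C)
    (Eventually.of_forall fun y v _ => by
      have h1 := (hc.differentiable one_ne_zero (y + v)).hasFDerivAt
      exact (hasFDerivAt_comp_add_left y).2 h1)
  simp only [integral_unitCube_add hf, add_zero] at h
  exact h.unique (hasFDerivAt_const _ _)

lemma integral_torus_gradient {f : Eucl n → ℝ} (hf : IsLatticePeriodic f) (hc : ContDiff ℝ 1 f) :
    ∫ x, descend (gradient f) x ∂torusMeasure n = 0 := by
  have hcg : Continuous (gradient f) :=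
    (InnerProductSpace.toDual ℝ (Eucl n)).symm.continuous.comp (hc.continuous_fderiv one_ne_zero)
  rw [integral_torusMeasure (continuous_descend hf.gradient hcg).aestronglyMeasurable]
  simp only [descend_mk hf.gradient]
  have h := (InnerProductSpace.toDual ℝ (Eucl n)).symm.toContinuousLinearEquiv.integral_comp_comm
    (μ := volume.restrict (unitCube n)) (fderiv ℝ f)
  rw [integral_unitCube_fderiv hf hc, map_zero] at h
  exact h

end Periodic

/-! ### Integration against a vector measure with density. -/

section VectorMeasureIntegral

variable {X F : Type*} {mX : MeasurableSpace X} [NormedAddCommGroup F] [NormedSpace ℝ F]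
  [CompleteSpace F] {μ : Measure X} {g : X → F}

/-- The integral of a bounded measurable function with respect to a vector measure with density. -/
lemma integral_withDensityᵥ_smul (hg : Integrable g μ) {φ : X → ℝ} (hφ : Measurable φ) {C : ℝ}
    (hC : ∀ x, ‖φ x‖ ≤ C) :
    (μ.withDensityᵥ g).integral φ (ContinuousLinearMap.lsmul ℝ ℝ) = ∫ x, φ x • g x ∂μ := by
  have hvar := Measure.variation_withDensityᵥ hg
  have hfin : IsFiniteMeasure (μ.withDensityᵥ g).variation := by
    rw [hvar]
    exact ⟨by simpa using! hg.2⟩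
  have hint : ∀ s : SimpleFunc X ℝ, ∀ C', (∀ x, ‖s x‖ ≤ C') →
      (μ.withDensityᵥ g).Integrable s := fun s C' h =>
    Integrable.of_bound (C := C') s.aestronglyMeasurable (Filter.Eventually.of_forall h)
  have hsimple : ∀ s : SimpleFunc X ℝ,
      (μ.withDensityᵥ g).integral s (ContinuousLinearMap.lsmul ℝ ℝ) = ∫ x, s x • g x ∂μ := by
    intro s
    induction s using SimpleFunc.induction with
    | @const c s hs =>
      have : ⇑(SimpleFunc.piecewise s hs (SimpleFunc.const X c) (SimpleFunc.const X 0)) =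
          s.indicator fun _ => c := by
        ext x
        by_cases hx : x ∈ s <;> simp [hx]
      rw [this, VectorMeasure.integral_indicator_const c hs, withDensityᵥ_apply hg hs]
      simp only [ContinuousLinearMap.lsmul_apply]
      rw [← integral_smul, ← integral_indicator hs]
      congr 1
      ext x
      by_cases hx : x ∈ s <;> simp [hx]
    | @add s t hst hs ht =>
      obtain ⟨A, hA⟩ := s.exists_forall_norm_le
      obtain ⟨B, hB⟩ := t.exists_forall_norm_le
      have h1 : ∀ s : SimpleFunc X ℝ, Integrable (fun x => s x • g x) μ := fun s => by
        obtain ⟨A, hA⟩ := s.exists_forall_norm_le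
        exact hg.bdd_smul A s.aestronglyMeasurable (Filter.Eventually.of_forall hA)
      rw [SimpleFunc.coe_add, VectorMeasure.integral_add (hint s A hA) (hint t B hB), hs, ht,
        ← integral_add (h1 s) (h1 t)]
      simp [add_smul]
  -- Both sides pass to the limit along simple functions bounded by the same `C`.
  have hC0 : ∀ x, 0 ≤ C := fun x => (norm_nonneg _).trans (hC x)
  have hs := hφ.stronglyMeasurable
  have hle : ∀ k x, ‖hs.approxBounded C k x‖ ≤ C := fun k x => hs.norm_approxBounded_le (hC0 x) k x
  have hlim : ∀ x, Tendsto (fun k => hs.approxBounded C k x) atTop (𝓝 (φ x)) := fun x =>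
    hs.tendsto_approxBounded_of_norm_le (hC x)
  have h1 := VectorMeasure.tendsto_integral_filter_of_norm_le_const (μ := μ.withDensityᵥ g)
    (B := ContinuousLinearMap.lsmul ℝ ℝ) (l := atTop)
    (Eventually.of_forall fun k => (hs.approxBounded C k).aestronglyMeasurable)
    ⟨C, Eventually.of_forall fun k => Eventually.of_forall (hle k)⟩ (Eventually.of_forall hlim)
  have h2 : Tendsto (fun k => ∫ x, hs.approxBounded C k x • g x ∂μ) atTop
      (𝓝 (∫ x, φ x • g x ∂μ)) := by
    refine tendsto_integral_of_dominated_convergence (fun x => C * ‖g x‖)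
      (fun k => (hs.approxBounded C k).aestronglyMeasurable.smul hg.aestronglyMeasurable)
      (hg.norm.const_mul C) (fun k => Eventually.of_forall fun x => ?_)
      (Eventually.of_forall fun x => (hlim x).smul_const _)
    rw [norm_smul]
    exact mul_le_mul_of_nonneg_right (hle k x) (norm_nonneg _)
  simp only [hsimple] at h1
  exact tendsto_nhds_unique h1 h2

end VectorMeasureIntegral

/-! ### Mollification of periodic functions. -/

section Mollification

open scoped Convolution

variable {F : Type*} [NormedAddCommGroup F] [NormedSpace ℝ F]

/-- The derivative is put on `f`, so that the derivative of the mollification is the mollification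
of `fderiv ℝ f`. Periodicity bounds `f` and its derivative, which gives the domination. -/
lemma hasFDerivAt_normed_convolution (φ : ContDiffBump (0 : Eucl n)) {f : Eucl n → F}
    (hf : IsLatticePeriodic f) (hc : ContDiff ℝ 1 f) (y : Eucl n) :
    HasFDerivAt (φ.normed volume ⋆[ContinuousLinearMap.lsmul ℝ ℝ, volume] f)
      ((φ.normed volume ⋆[ContinuousLinearMap.lsmul ℝ ℝ, volume] fderiv ℝ f) y) y := by
  have hcf : Continuous (fderiv ℝ f) := hc.continuous_fderiv one_ne_zero
  obtain ⟨C, hC⟩ := exists_norm_le_of_isLatticePeriodic hf.fderiv hcf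
  obtain ⟨C', hC'⟩ := exists_norm_le_of_isLatticePeriodic hf hc.continuous
  have hφ : Integrable (φ.normed volume) (volume : Measure (Eucl n)) := φ.integrable_normed
  have hsub : ∀ x : Eucl n, Continuous fun t : Eucl n => x - t := fun x => by fun_prop
  refine hasFDerivAt_integral_of_dominated_of_fderiv_le (𝕜 := ℝ)
    (F := fun x t => φ.normed volume t • f (x - t))
    (F' := fun x t => φ.normed volume t • fderiv ℝ f (x - t)) (s := univ)
    (bound := fun t => ‖φ.normed volume t‖ * C)
    univ_mem
    (Eventually.of_forall fun x => hφ.aestronglyMeasurable.smul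
      (hc.continuous.comp (hsub x)).aestronglyMeasurable)
    ?_ (hφ.aestronglyMeasurable.smul (hcf.comp (hsub y)).aestronglyMeasurable)
    (Eventually.of_forall fun t x _ => ?_) (hφ.norm.mul_const C)
    (Eventually.of_forall fun t x _ => ?_)
  · exact hφ.smul_bdd C' (hc.continuous.comp (hsub y)).aestronglyMeasurable
      (Eventually.of_forall fun t => hC' _)
  · rw [norm_smul]
    exact mul_le_mul_of_nonneg_left (hC _) (norm_nonneg _)
  · have h1 := (hc.differentiable one_ne_zero (x - t)).hasFDerivAt
    exact ((hasFDerivAt_comp_sub t).2 h1).const_smul (φ.normed volume t)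

/-- A periodic `C¹` function is a uniform limit, together with its derivative, of periodic smooth
functions. -/
lemma exists_smooth_periodic_approx [CompleteSpace F] {f : Eucl n → F} (hf : IsLatticePeriodic f)
    (hc : ContDiff ℝ 1 f) {ε : ℝ} (hε : 0 < ε) :
    ∃ g : Eucl n → F, ContDiff ℝ ∞ g ∧ IsLatticePeriodic g ∧ (∀ y, ‖g y - f y‖ ≤ ε) ∧
      ∀ y, ‖fderiv ℝ g y - fderiv ℝ f y‖ ≤ ε := by
  have hcf : Continuous (fderiv ℝ f) := hc.continuous_fderiv one_ne_zero
  obtain ⟨δ₁, hδ₁, h₁⟩ := Metric.uniformContinuous_iff.1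
    (uniformContinuous_of_isLatticePeriodic hf hc.continuous) ε hε
  obtain ⟨δ₂, hδ₂, h₂⟩ := Metric.uniformContinuous_iff.1
    (uniformContinuous_of_isLatticePeriodic hf.fderiv hcf) ε hε
  -- The kernel's support radius obeys the moduli of continuity of both `f` and its derivative.
  have hδ : 0 < min δ₁ δ₂ := lt_min hδ₁ hδ₂
  let φ : ContDiffBump (0 : Eucl n) := ⟨min δ₁ δ₂ / 2, min δ₁ δ₂, half_pos hδ, half_lt_self hδ⟩
  refine ⟨φ.normed volume ⋆[ContinuousLinearMap.lsmul ℝ ℝ, volume] f, ?_, ?_, fun y => ?_,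
    fun y => ?_⟩
  · exact φ.hasCompactSupport_normed.contDiff_convolution_left _ φ.contDiff_normed
      hc.continuous.locallyIntegrable
  · intro y k hk
    simp only [convolution_def]
    congr 1
    ext t
    rw [add_sub_right_comm, hf _ _ hk]
  · rw [← dist_eq_norm]
    exact φ.dist_normed_convolution_le hc.continuous.aestronglyMeasurable fun x hx =>
      (h₁ (lt_of_lt_of_le hx (min_le_left _ _))).le
  · rw [(hasFDerivAt_normed_convolution φ hf hc y).fderiv, ← dist_eq_norm]
    exact φ.dist_normed_convolution_le hcf.aestronglyMeasurable fun x hx =>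
      (h₂ (lt_of_lt_of_le hx (min_le_right _ _))).le

end Mollification

/-! ### Integration by parts of `BV` functions against smooth fields. -/

section Calibration

open scoped RealInnerProductSpace

lemma continuous_of_continuous_lift {X : Type*} [TopologicalSpace X] {φ : Torus n → X}
    (h : Continuous fun y : Eucl n => φ (y : Torus n)) : Continuous φ :=
  isQuotientMap_quot_mk.continuous_iff.2 h

lemma torusGradient_eq_descend (φ : Torus n → ℝ) :
    torusGradient φ = descend (gradient fun y : Eucl n => φ (y : Torus n)) := by
  ext1 x
  obtain ⟨y, rfl⟩ := QuotientAddGroup.mk_surjective x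
  rw [torusGradient_mk, descend_mk (isLatticePeriodic_lift φ).gradient]

lemma continuous_gradient {f : Eucl n → ℝ} (hf : ContDiff ℝ 1 f) : Continuous (gradient f) :=
  (InnerProductSpace.toDual ℝ (Eucl n)).symm.continuous.comp (hf.continuous_fderiv one_ne_zero)

lemma IsSmooth.continuous {φ : Torus n → ℝ} (hφ : IsSmooth φ) : Continuous φ :=
  continuous_of_continuous_lift (ContDiff.continuous hφ)

lemma IsSmooth.continuous_torusGradient {φ : Torus n → ℝ} (hφ : IsSmooth φ) :
    Continuous (torusGradient φ) := by
  rw [torusGradient_eq_descend]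
  exact continuous_descend (isLatticePeriodic_lift φ).gradient
    (continuous_gradient (ContDiff.of_le hφ (by exact_mod_cast le_top)))

lemma isSmooth_descend {f : Eucl n → ℝ} (hf : IsLatticePeriodic f) (hc : ContDiff ℝ ∞ f) :
    IsSmooth (descend f) := by
  unfold IsSmooth
  simpa only [descend_mk hf] using hc

lemma exists_norm_le_torus {F : Type*} [NormedAddCommGroup F] {f : Torus n → F}
    (hf : Continuous f) : ∃ C, ∀ x, ‖f x‖ ≤ C := by
  obtain ⟨C, hC⟩ := (isCompact_range hf).isBounded.exists_norm_le
  exact ⟨C, fun y => hC _ ⟨y, rfl⟩⟩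

/-- The gradient of the periodic product `φ ψ` has integral zero. -/
lemma IsSmooth.isGradientMeasure {ψ : Torus n → ℝ} (hψ : IsSmooth ψ) {u : Torus n → ℝ}
    (hu : u =ᵐ[torusMeasure n] ψ) :
    IsGradientMeasure u ((torusMeasure n).withDensityᵥ (torusGradient ψ)) := by
  have hcg := hψ.continuous_torusGradient
  obtain ⟨C, hC⟩ := exists_norm_le_torus hcg
  have hg : Integrable (torusGradient ψ) (torusMeasure n) :=
    Integrable.of_bound (C := C) hcg.aestronglyMeasurable (Eventually.of_forall hC)
  refine ⟨?_, fun φ hφ => ?_⟩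
  · rw [Measure.variation_withDensityᵥ hg]
    simpa using! hg.2
  · obtain ⟨C', hC'⟩ := exists_norm_le_torus hφ.continuous
    obtain ⟨A, hA⟩ := exists_norm_le_torus hψ.continuous
    have hcg' := hφ.continuous_torusGradient
    obtain ⟨B, hB⟩ := exists_norm_le_torus hcg'
    have hg' : Integrable (torusGradient φ) (torusMeasure n) :=
      Integrable.of_bound (C := B) hcg'.aestronglyMeasurable (Eventually.of_forall hB)
    rw [integral_withDensityᵥ_smul hg hφ.continuous.measurable hC']
    have h1 : ∫ x, u x • torusGradient φ x ∂torusMeasure n =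
        ∫ x, ψ x • torusGradient φ x ∂torusMeasure n :=
      integral_congr_ae (hu.mono fun x hx => by simp only [hx])
    have h2 : Integrable (fun x => φ x • torusGradient ψ x) (torusMeasure n) :=
      hg.bdd_smul C' hφ.continuous.aestronglyMeasurable (Eventually.of_forall hC')
    have h3 : Integrable (fun x => ψ x • torusGradient φ x) (torusMeasure n) :=
      hg'.bdd_smul A hψ.continuous.aestronglyMeasurable (Eventually.of_forall hA)
    rw [h1, eq_neg_iff_add_eq_zero, ← integral_add h2 h3]
    have hp := (isLatticePeriodic_lift fun x => φ x * ψ x)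
    have hφ1 : ContDiff ℝ 1 fun y : Eucl n => φ (y : Torus n) :=
      ContDiff.of_le hφ (by exact_mod_cast le_top)
    have hψ1 : ContDiff ℝ 1 fun y : Eucl n => ψ (y : Torus n) :=
      ContDiff.of_le hψ (by exact_mod_cast le_top)
    rw [← integral_torus_gradient hp (hφ1.mul hψ1),
      ← torusGradient_eq_descend fun x => φ x * ψ x]
    congr 1
    ext1 x
    obtain ⟨y, rfl⟩ := QuotientAddGroup.mk_surjective x
    simp only [torusGradient_mk, gradient]
    rw [fderiv_fun_mul (hφ1.differentiable one_ne_zero y) (hψ1.differentiable one_ne_zero y)]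
    simp

/-- The divergence of a vector field. -/
def divergence (z : Eucl n → Eucl n) (y : Eucl n) : ℝ :=
  ∑ i, fderiv ℝ z y (EuclideanSpace.single i 1) i

lemma IsLatticePeriodic.divergence {z : Eucl n → Eucl n} (hz : IsLatticePeriodic z) :
    IsLatticePeriodic (divergence z) :=
  hz.fderiv.comp fun L => ∑ i, L (EuclideanSpace.single i 1) i

lemma continuous_divergence {z : Eucl n → Eucl n} (hz : ContDiff ℝ 1 z) :
    Continuous (divergence z) := by
  have h := hz.continuous_fderiv one_ne_zero
  unfold divergence
  fun_prop

lemma abs_divergence_sub_le {z w : Eucl n → Eucl n} {ε : ℝ} {y : Eucl n}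
    (h : ‖fderiv ℝ z y - fderiv ℝ w y‖ ≤ ε) : |divergence z y - divergence w y| ≤ n * ε := by
  unfold divergence
  rw [← Finset.sum_sub_distrib]
  refine (Finset.abs_sum_le_sum_abs _ _).trans ?_
  have : ∀ i ∈ Finset.univ, |fderiv ℝ z y (EuclideanSpace.single i 1) i -
      fderiv ℝ w y (EuclideanSpace.single i 1) i| ≤ ε := by
    intro i _
    have h1 := (fderiv ℝ z y - fderiv ℝ w y).le_opNorm (EuclideanSpace.single i 1)
    have h2 := PiLp.norm_apply_le ((fderiv ℝ z y - fderiv ℝ w y) (EuclideanSpace.single i 1)) i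
    simp only [PiLp.norm_single, norm_one, mul_one] at h1
    simpa using h2.trans (h1.trans h)
  simpa using Finset.sum_le_sum this

lemma integrable_mul_coord {m : Measure (Torus n)} {f : Torus n → Eucl n} (hf : Integrable f m)
    {φ : Torus n → ℝ} (hφ : Continuous φ) (i : Fin n) : Integrable (fun x => φ x * f x i) m := by
  obtain ⟨C, hC⟩ := exists_norm_le_torus hφ
  exact ((EuclideanSpace.proj (𝕜 := ℝ) i).integrable_comp hf).bdd_mul (c := C)
    hφ.aestronglyMeasurable (Eventually.of_forall hC)

lemma integral_smul_apply {m : Measure (Torus n)} {f : Torus n → Eucl n} (hf : Integrable f m)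
    {φ : Torus n → ℝ} (hφ : Continuous φ) (i : Fin n) :
    (∫ x, φ x • f x ∂m) i = ∫ x, φ x * f x i ∂m := by
  obtain ⟨C, hC⟩ := exists_norm_le_torus hφ
  have h : Integrable (fun x => φ x • f x) m :=
    hf.bdd_smul C hφ.aestronglyMeasurable (Eventually.of_forall hC)
  exact ((EuclideanSpace.proj (𝕜 := ℝ) i).integral_comp_comm h).symm

lemma integrable_mul_torusGradient {u : Torus n → ℝ} (hu : Integrable u (torusMeasure n))
    {φ : Torus n → ℝ} (hφ : IsSmooth φ) (i : Fin n) :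
    Integrable (fun x => u x * torusGradient φ x i) (torusMeasure n) := by
  obtain ⟨C, hC⟩ := exists_norm_le_torus hφ.continuous_torusGradient
  have h : Integrable (fun x => u x • torusGradient φ x) (torusMeasure n) :=
    hu.smul_bdd C hφ.continuous_torusGradient.aestronglyMeasurable (Eventually.of_forall hC)
  exact (EuclideanSpace.proj (𝕜 := ℝ) i).integrable_comp h

/-- Gradient measures are tested with scalar functions; taking single coordinates allows a different
test function `z i` for each `i`, and these then sum to a divergence. -/
lemma IsLebesguePolar.integral_coord {u : Torus n → ℝ} (hu : Integrable u (torusMeasure n))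
    {D : VectorMeasure (Torus n) (Eucl n)} (hD : IsGradientMeasure u D) {g : Torus n → Eucl n}
    {S : VectorMeasure (Torus n) (Eucl n)} {σ : Torus n → Eucl n} (hp : IsLebesguePolar D g S σ)
    {φ : Torus n → ℝ} (hφ : IsSmooth φ) (i : Fin n) :
    ∫ x, φ x * g x i ∂torusMeasure n + ∫ x, φ x * σ x i ∂S.variation =
      -∫ x, u x * torusGradient φ x i ∂torusMeasure n := by
  have hg := hp.integrable_density
  have hσ := hp.integrable_polar
  have hvar := Measure.variation_withDensityᵥ hg
  have hvarS := Measure.variation_withDensityᵥ hσ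
  rw [← hp.polar] at hvarS
  have hfinS : IsFiniteMeasure S.variation := by
    rw [hvarS]
    exact ⟨by simpa using! hσ.2⟩
  have hfing : IsFiniteMeasure ((torusMeasure n).withDensityᵥ g).variation := by
    rw [hvar]
    exact ⟨by simpa using! hg.2⟩
  obtain ⟨C, hC⟩ := exists_norm_le_torus hφ.continuous
  obtain ⟨C', hC'⟩ := exists_norm_le_torus hφ.continuous_torusGradient
  have hm := hφ.continuous.measurable
  have h1 := hD.integral_eq φ hφ
  have hint : ∀ V : VectorMeasure (Torus n) (Eucl n), IsFiniteMeasure V.variation →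
      V.Integrable φ := fun V hV =>
    Integrable.of_bound (C := C) hm.aestronglyMeasurable (Eventually.of_forall hC)
  rw [hp.decomposition, VectorMeasure.integral_add_vectorMeasure (hint _ hfing) (hint _ hfinS),
    integral_withDensityᵥ_smul hg hm hC] at h1
  have h2 := integral_withDensityᵥ_smul hσ hm hC
  rw [← hp.polar] at h2
  rw [h2] at h1
  have h4 : Integrable (fun x => u x • torusGradient φ x) (torusMeasure n) :=
    hu.smul_bdd C' hφ.continuous_torusGradient.aestronglyMeasurable (Eventually.of_forall hC')
  have h5 : (∫ x, u x • torusGradient φ x ∂torusMeasure n) i =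
      ∫ x, u x * torusGradient φ x i ∂torusMeasure n :=
    ((EuclideanSpace.proj (𝕜 := ℝ) i).integral_comp_comm h4).symm
  have h3 := congrArg (fun w : Eucl n => w i) h1
  simp only [PiLp.add_apply, PiLp.neg_apply] at h3
  rwa [integral_smul_apply hg hφ.continuous, integral_smul_apply hσ hφ.continuous, h5] at h3

lemma torusGradient_descend_apply {z : Eucl n → Eucl n} (hz : IsLatticePeriodic z)
    {y : Eucl n} (hd : DifferentiableAt ℝ z y) (i : Fin n) :
    torusGradient (descend fun y => z y i) (y : Torus n) i =
      fderiv ℝ z y (EuclideanSpace.single i 1) i := by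
  have hpi : IsLatticePeriodic fun y => z y i := hz.comp fun w => w i
  have h2 : HasFDerivAt (fun y => z y i) ((EuclideanSpace.proj (𝕜 := ℝ) i).comp (fderiv ℝ z y)) y :=
    (EuclideanSpace.proj (𝕜 := ℝ) i).hasFDerivAt.comp y hd.hasFDerivAt
  rw [torusGradient_mk]
  simp only [descend_mk hpi]
  rw [gradient, h2.fderiv]
  have h3 := InnerProductSpace.toDual_symm_apply (𝕜 := ℝ)
    (x := EuclideanSpace.single i (1 : ℝ))
    (y := (EuclideanSpace.proj (𝕜 := ℝ) i).comp (fderiv ℝ z y))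
  rw [EuclideanSpace.inner_single_right] at h3
  simpa using h3

lemma IsLebesguePolar.integral_smooth {u : Torus n → ℝ} (hu : Integrable u (torusMeasure n))
    {D : VectorMeasure (Torus n) (Eucl n)} (hD : IsGradientMeasure u D) {g : Torus n → Eucl n}
    {S : VectorMeasure (Torus n) (Eucl n)} {σ : Torus n → Eucl n} (hp : IsLebesguePolar D g S σ)
    {z : Eucl n → Eucl n} (hz : IsLatticePeriodic z) (hc : ContDiff ℝ ∞ z) :
    ∫ x, ⟪descend z x, g x⟫ ∂torusMeasure n + ∫ x, ⟪descend z x, σ x⟫ ∂S.variation =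
      -∫ x, u x * descend (divergence z) x ∂torusMeasure n := by
  have hci : ∀ i, ContDiff ℝ ∞ fun y => z y i := fun i => by fun_prop
  have hpi : ∀ i, IsLatticePeriodic fun y => z y i := fun i => hz.comp fun w => w i
  have hφ : ∀ i, IsSmooth (descend fun y => z y i) := fun i => isSmooth_descend (hpi i) (hci i)
  have hsum := Finset.sum_congr rfl fun i (_ : i ∈ Finset.univ) => hp.integral_coord hu hD (hφ i) i
  rw [Finset.sum_add_distrib, Finset.sum_neg_distrib,
    ← integral_finsetSum _ fun i _ => integrable_mul_coord hp.integrable_density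
      (hφ i).continuous i,
    ← integral_finsetSum _ fun i _ => integrable_mul_coord hp.integrable_polar
      (hφ i).continuous i,
    ← integral_finsetSum _ fun i _ => integrable_mul_torusGradient hu (hφ i) i] at hsum
  have hin : ∀ (f : Torus n → Eucl n) x,
      ⟪descend z x, f x⟫ = ∑ i, (descend fun y => z y i) x * f x i := by
    intro f x
    simp [descend, PiLp.inner_apply, mul_comm]
  simp only [hin]
  rw [hsum]
  congr 2
  ext x
  obtain ⟨y, rfl⟩ := QuotientAddGroup.mk_surjective x
  rw [← Finset.mul_sum, descend_mk hz.divergence]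
  congr 1
  exact Finset.sum_congr rfl fun i _ =>
    torusGradient_descend_apply hz (hc.differentiable (by simp) y) i

end Calibration

/-! ### Calibrated functions lie in the domain of the subdifferential. -/

section Subdifferential

open scoped RealInnerProductSpace

/-- Since `W` is only `C²` off the origin, the calibrating field is only `C¹`. Mollifying it makes
the fields and their divergences converge with uniform bounds, so dominated convergence applies to
all three integrals. -/
lemma IsLebesguePolar.integral_contDiff {u : Torus n → ℝ} (hu : Integrable u (torusMeasure n))
    {D : VectorMeasure (Torus n) (Eucl n)} (hD : IsGradientMeasure u D) {g : Torus n → Eucl n}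
    {S : VectorMeasure (Torus n) (Eucl n)} {σ : Torus n → Eucl n} (hp : IsLebesguePolar D g S σ)
    {z : Eucl n → Eucl n} (hz : IsLatticePeriodic z) (hc : ContDiff ℝ 1 z) :
    ∫ x, ⟪descend z x, g x⟫ ∂torusMeasure n + ∫ x, ⟪descend z x, σ x⟫ ∂S.variation =
      -∫ x, u x * descend (divergence z) x ∂torusMeasure n := by
  have hpos : ∀ k : ℕ, 0 < 1 / ((k : ℝ) + 1) := fun k => Nat.one_div_pos_of_nat
  have hle1 : ∀ k : ℕ, 1 / ((k : ℝ) + 1) ≤ 1 := fun k => by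
    rw [div_le_one (by positivity)]
    linarith [Nat.cast_nonneg (α := ℝ) k]
  choose w hw hwp hwz hwd using fun k : ℕ => exists_smooth_periodic_approx hz hc (hpos k)
  have hwc : ∀ k, ContDiff ℝ 1 (w k) := fun k => (hw k).of_le (by exact_mod_cast le_top)
  obtain ⟨C, hC⟩ := exists_norm_le_of_isLatticePeriodic hz hc.continuous
  obtain ⟨C', hC'⟩ := exists_norm_le_of_isLatticePeriodic hz.divergence (continuous_divergence hc)
  have hdiv : ∀ k y, |divergence (w k) y - divergence z y| ≤ n * (1 / ((k : ℝ) + 1)) :=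
    fun k y => abs_divergence_sub_le (hwd k y)
  have hlim : ∀ x, Tendsto (fun k => descend (w k) x) atTop (𝓝 (descend z x)) := fun x =>
    tendsto_iff_norm_sub_tendsto_zero.2 (squeeze_zero (fun _ => norm_nonneg _)
      (fun k => hwz k _) tendsto_one_div_add_atTop_nhds_zero_nat)
  have hlimd : ∀ x, Tendsto (fun k => descend (divergence (w k)) x) atTop
      (𝓝 (descend (divergence z) x)) := fun x => by
    refine tendsto_iff_norm_sub_tendsto_zero.2 (squeeze_zero (fun _ => norm_nonneg _)
      (fun k => hdiv k _) ?_)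
    simpa using (tendsto_one_div_add_atTop_nhds_zero_nat (𝕜 := ℝ)).const_mul (n : ℝ)
  have hwb : ∀ k y, ‖w k y‖ ≤ C + 1 := fun k y => by
    have h1 := norm_sub_norm_le (w k y) (z y)
    linarith [hwz k y, hC y, hle1 k]
  have hdb : ∀ k y, ‖divergence (w k) y‖ ≤ C' + n := fun k y => by
    have h1 := norm_sub_norm_le (divergence (w k) y) (divergence z y)
    have h2 := hdiv k y
    have h3 : (n : ℝ) * (1 / ((k : ℝ) + 1)) ≤ n * 1 :=
      mul_le_mul_of_nonneg_left (hle1 k) (Nat.cast_nonneg n)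
    rw [← Real.norm_eq_abs] at h2
    linarith [hC' y]
  have hin : ∀ (m : Measure (Torus n)) (f : Torus n → Eucl n), Integrable f m →
      Tendsto (fun k => ∫ x, ⟪descend (w k) x, f x⟫ ∂m) atTop
        (𝓝 (∫ x, ⟪descend z x, f x⟫ ∂m)) := by
    intro m f hf
    refine tendsto_integral_of_dominated_convergence (fun x => (C + 1) * ‖f x‖) (fun k => ?_)
      (hf.norm.const_mul _) (fun k => Eventually.of_forall fun x => ?_)
      (Eventually.of_forall fun x => (hlim x).inner tendsto_const_nhds)
    · exact (continuous_descend (hwp k) (hw k).continuous).aestronglyMeasurable.inner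
        hf.aestronglyMeasurable
    · exact (norm_inner_le_norm _ _).trans
        (mul_le_mul_of_nonneg_right (hwb k _) (norm_nonneg _))
  have hr : Tendsto (fun k => ∫ x, u x * descend (divergence (w k)) x ∂torusMeasure n) atTop
      (𝓝 (∫ x, u x * descend (divergence z) x ∂torusMeasure n)) := by
    refine tendsto_integral_of_dominated_convergence (fun x => ‖u x‖ * (C' + n)) (fun k => ?_)
      (hu.norm.mul_const _) (fun k => Eventually.of_forall fun x => ?_)
      (Eventually.of_forall fun x => (hlimd x).const_mul _)
    · exact hu.aestronglyMeasurable.mul (continuous_descend (hwp k).divergence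
        (continuous_divergence (hwc k))).aestronglyMeasurable
    · rw [norm_mul]
      exact mul_le_mul_of_nonneg_left (hdb k _) (norm_nonneg _)
  refine tendsto_nhds_unique ((hin _ g hp.integrable_density).add (hin _ σ hp.integrable_polar)) ?_
  refine hr.neg.congr fun k => ?_
  exact (hp.integral_smooth hu hD (hwp k) (hw k)).symm

lemma ofReal_integral_le_lintegral_ofReal {X : Type*} [MeasurableSpace X] {m : Measure X}
    {f : X → ℝ} (hf : Integrable f m) :
    ENNReal.ofReal (∫ x, f x ∂m) ≤ ∫⁻ x, ENNReal.ofReal (f x) ∂m := by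
  rw [integral_eq_lintegral_pos_part_sub_lintegral_neg_part hf]
  refine (ENNReal.ofReal_le_ofReal (sub_le_self _ ENNReal.toReal_nonneg)).trans ?_
  exact ENNReal.ofReal_toReal_le

variable {W : Eucl n → ℝ} {z : Eucl n → Eucl n}

lemma integrable_inner_descend (hz : IsLatticePeriodic z) (hc : Continuous z)
    {m : Measure (Torus n)} {f : Torus n → Eucl n} (hf : Integrable f m) :
    Integrable (fun x => ⟪descend z x, f x⟫) m := by
  obtain ⟨C, hC⟩ := exists_norm_le_of_isLatticePeriodic hz hc
  refine (hf.norm.const_mul C).mono'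
    ((continuous_descend hz hc).aestronglyMeasurable.inner hf.aestronglyMeasurable)
    (Eventually.of_forall fun x => ?_)
  exact (norm_inner_le_norm _ _).trans (mul_le_mul_of_nonneg_right (hC _) (norm_nonneg _))

/-- The energy of a function is bounded below by its pairing with the divergence of a field in the
Wulff shape of `W`. -/
lemma le_energy (hz : IsLatticePeriodic z) (hc : ContDiff ℝ 1 z)
    (hzW : ∀ y p, ⟪z y, p⟫ ≤ W p) (u : TorusL2 n) :
    ((-∫ x, u x * descend (divergence z) x ∂torusMeasure n : ℝ) : EReal) ≤ energy W u := by
  have hu : Integrable u (torusMeasure n) := (Lp.memLp u).integrable (by norm_num)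
  set I := -∫ x, u x * descend (divergence z) x ∂torusMeasure n with hI
  -- `I` may be negative; `ENNReal.ofReal` then replaces it by `0`, which only strengthens the lower
  -- bound to be shown.
  have h0 : (I : EReal) ≤ ((ENNReal.ofReal I : ℝ≥0∞) : EReal) := by
    rw [EReal.coe_ennreal_ofReal]
    exact EReal.coe_le_coe_iff.2 (le_max_left _ _)
  refine h0.trans (EReal.coe_ennreal_le_coe_ennreal_iff.2 ?_)
  -- The bound holds for every gradient measure and every decomposition, so their uniqueness plays
  -- no role.
  refine le_iInf₂ fun D hD => le_iInf₂ fun g S => le_iInf₂ fun σ hp => ?_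
  rw [hI, ← hp.integral_contDiff hu hD hz hc]
  refine ENNReal.ofReal_add_le.trans (add_le_add ?_ ?_)
  · exact (ofReal_integral_le_lintegral_ofReal
      (integrable_inner_descend hz hc.continuous hp.integrable_density)).trans
      (lintegral_mono fun x => ENNReal.ofReal_le_ofReal (hzW _ _))
  · exact (ofReal_integral_le_lintegral_ofReal
      (integrable_inner_descend hz hc.continuous hp.integrable_polar)).trans
      (lintegral_mono fun x => ENNReal.ofReal_le_ofReal (hzW _ _))

lemma IsSmooth.integrable_torusGradient {ψ : Torus n → ℝ} (hψ : IsSmooth ψ) :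
    Integrable (torusGradient ψ) (torusMeasure n) := by
  obtain ⟨C, hC⟩ := exists_norm_le_torus hψ.continuous_torusGradient
  exact Integrable.of_bound (C := C) hψ.continuous_torusGradient.aestronglyMeasurable
    (Eventually.of_forall hC)

lemma IsSmooth.isLebesguePolar {ψ : Torus n → ℝ} (hψ : IsSmooth ψ) :
    IsLebesguePolar ((torusMeasure n).withDensityᵥ (torusGradient ψ)) (torusGradient ψ) 0 0 where
  integrable_density := hψ.integrable_torusGradient
  decomposition := (add_zero _).symm
  singular := by
    rw [VectorMeasure.variation_eq_zero.2 rfl]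
    exact Measure.MutuallySingular.zero_left
  integrable_polar := integrable_zero _ _ _
  polar := by simp

/-- An infimum is at most any one of its members: the one used is the absolutely continuous measure
`∇ψ dx` with zero singular part, on which calibration turns `W (∇ψ)` into `⟪z, ∇ψ⟫`. -/
lemma energy_le {ψ : Torus n → ℝ} (hψ : IsSmooth ψ) (hm : MemLp ψ 2 (torusMeasure n))
    (hW : ∀ p, 0 ≤ W p)
    (hz : IsLatticePeriodic z) (hc : ContDiff ℝ 1 z)
    (hzψ : ∀ x, ⟪descend z x, torusGradient ψ x⟫ = W (torusGradient ψ x)) :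
    energy W (hm.toLp ψ) ≤
      ((-∫ x, hm.toLp ψ x * descend (divergence z) x ∂torusMeasure n : ℝ) : EReal) := by
  have hu : Integrable (hm.toLp ψ) (torusMeasure n) := (Lp.memLp _).integrable (by norm_num)
  have hD := hψ.isGradientMeasure hm.coeFn_toLp
  have hp := hψ.isLebesguePolar
  rw [← hp.integral_contDiff hu hD hz hc]
  have h1 : anisotropicMass W ((torusMeasure n).withDensityᵥ (torusGradient ψ)) ≤ _ :=
    iInf₂_le_of_le _ _ (iInf₂_le _ hp)
  have h2 : energy W (hm.toLp ψ) ≤ _ :=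
    EReal.coe_ennreal_le_coe_ennreal_iff.2 ((iInf₂_le _ hD).trans h1)
  refine h2.trans (le_of_eq ?_)
  have hnn : 0 ≤ ∫ x, ⟪descend z x, torusGradient ψ x⟫ ∂torusMeasure n :=
    integral_nonneg fun x => (hW _).trans_eq (hzψ x).symm
  have h3 := ofReal_integral_eq_lintegral_ofReal
    (integrable_inner_descend hz hc.continuous hψ.integrable_torusGradient)
    (Eventually.of_forall fun x => (hW _).trans_eq (hzψ x).symm)
  simp only [← hzψ]
  rw [VectorMeasure.variation_eq_zero.2 rfl, lintegral_zero_measure, integral_zero_measure,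
    add_zero, add_zero, ← h3, EReal.coe_ennreal_ofReal, max_eq_left hnn]

/-- A smooth function whose gradient is calibrated by a `C¹` field belongs to the domain of the
subdifferential of the anisotropic total variation. -/
lemma mem_domSubdifferential_of_calibration {ψ : Torus n → ℝ} (hψ : IsSmooth ψ)
    (hm : MemLp ψ 2 (torusMeasure n)) (hW : ∀ p, 0 ≤ W p)
    (hz : IsLatticePeriodic z) (hc : ContDiff ℝ 1 z) (hzW : ∀ y p, ⟪z y, p⟫ ≤ W p)
    (hzψ : ∀ x, ⟪descend z x, torusGradient ψ x⟫ = W (torusGradient ψ x)) :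
    hm.toLp ψ ∈ domSubdifferential (energy W) := by
  have hcd := continuous_descend hz.divergence (continuous_divergence hc)
  obtain ⟨C, hC⟩ := exists_norm_le_torus hcd
  have hv : MemLp (fun x => -descend (divergence z) x) 2 (torusMeasure n) :=
    MemLp.of_bound hcd.neg.aestronglyMeasurable C
      (Eventually.of_forall fun x => by rw [norm_neg]; exact hC x)
  have hinner : ∀ u : TorusL2 n, ⟪u, hv.toLp _⟫ =
      -∫ x, u x * descend (divergence z) x ∂torusMeasure n := by
    intro u
    rw [L2.inner_def, ← integral_neg]
    refine integral_congr_ae (hv.coeFn_toLp.mono fun x hx => ?_)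
    simp only [hx]
    simp [mul_comm]
  have hle := energy_le hψ hm hW hz hc hzψ
  refine ⟨hv.toLp _, fun h => ?_, fun h => ?_⟩
  · rw [h] at hle
    exact EReal.coe_ne_top _ (top_le_iff.1 hle)
  -- `E(ψ) + ⟪h, v⟫ ≤ ⟪ψ, v⟫ + ⟪h, v⟫ = ⟪ψ + h, v⟫ ≤ E(ψ + h)`.
  · refine (add_le_add_left hle _).trans ?_
    rw [← hinner, ← EReal.coe_add, ← inner_add_left, hinner]
    exact le_energy hz hc hzW _

end Subdifferential

/-! ### Global defining functions for sets with smooth boundary. -/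

section DefiningFunction

/-- A smooth function that is nonnegative on `A` and nonpositive off `A`. -/
structure IsSignAdapted (A : Set (Eucl n)) (h : Eucl n → ℝ) : Prop where
  contDiff : ContDiff ℝ ∞ h
  nonneg : ∀ y ∈ A, 0 ≤ h y
  nonpos : ∀ y ∉ A, h y ≤ 0

/-- The complement of the critical zeros of `h`. -/
def regularSet (h : Eucl n → ℝ) : Set (Eucl n) := {y | h y ≠ 0 ∨ fderiv ℝ h y ≠ 0}

variable {A : Set (Eucl n)} {h r : Eucl n → ℝ}

lemma isOpen_regularSet (hc : ContDiff ℝ ∞ h) : IsOpen (regularSet h) :=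
  (isOpen_ne_fun hc.continuous continuous_const).union
    (isOpen_ne_fun (hc.continuous_fderiv (by simp)) continuous_const)

lemma exists_pos_on_segment {y : Eucl n} (hd : DifferentiableAt ℝ h y) (h0 : h y = 0)
    {v : Eucl n} (hv : 0 < fderiv ℝ h y v) : ∀ᶠ t : ℝ in 𝓝[>] 0, 0 < h (y + t • v) := by
  have h1 : HasDerivAt (fun t : ℝ => h (y + t • v)) (fderiv ℝ h y v) 0 :=
    hd.hasFDerivAt.hasLineDerivAt v
  have h2 := (hasDerivWithinAt_iff_tendsto_slope' self_notMem_Ioi).1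
    (h1.hasDerivWithinAt (s := Ioi 0))
  filter_upwards [h2.eventually (lt_mem_nhds hv), self_mem_nhdsWithin] with t ht ht0
  simp only [slope, sub_zero, zero_smul, add_zero, h0, vsub_eq_sub, smul_eq_mul] at ht
  exact (pos_iff_pos_of_mul_pos ht).1 (inv_pos.2 ht0)

lemma IsSignAdapted.add (hh : IsSignAdapted A h) (hr : IsSignAdapted A r) :
    IsSignAdapted A (fun y => h y + r y) where
  contDiff := hh.contDiff.add hr.contDiff
  nonneg y hy := add_nonneg (hh.nonneg y hy) (hr.nonneg y hy)
  nonpos y hy := add_nonpos (hh.nonpos y hy) (hr.nonpos y hy)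

/-- Values of equal sign cannot cancel, so a zero of the sum is a common zero of `h` and `r`. If
their differentials cancelled there without vanishing, then along a direction in which `h` increases
`r` would decrease, and nearby the two would have opposite strict signs. -/
lemma IsSignAdapted.regularSet_subset_add (hh : IsSignAdapted A h) (hr : IsSignAdapted A r) :
    regularSet h ⊆ regularSet (fun y => h y + r y) := by
  intro y hy
  by_contra hcon
  simp only [regularSet, mem_ofPred_eq, not_or, not_not] at hcon
  obtain ⟨h0, hD⟩ := hcon
  have hdh : DifferentiableAt ℝ h y := hh.contDiff.differentiable (by simp) y
  have hdr : DifferentiableAt ℝ r y := hr.contDiff.differentiable (by simp) y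
  rw [fderiv_fun_add hdh hdr] at hD
  have hy0 : h y = 0 ∧ r y = 0 := by
    by_cases hA : y ∈ A
    · have := hh.nonneg y hA
      have := hr.nonneg y hA
      constructor <;> linarith
    · have := hh.nonpos y hA
      have := hr.nonpos y hA
      constructor <;> linarith
  rcases hy with hy | hy
  · exact hy hy0.1
  · obtain ⟨v, hv⟩ : ∃ v, 0 < fderiv ℝ h y v := by
      obtain ⟨v, hv⟩ : ∃ v, fderiv ℝ h y v ≠ 0 := by
        by_contra! hc
        exact hy (ContinuousLinearMap.ext hc)
      rcases lt_or_gt_of_ne hv with hv | hv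
      · exact ⟨-v, by rw [map_neg]; linarith⟩
      · exact ⟨v, hv⟩
    have h1 := exists_pos_on_segment hdh hy0.1 hv
    have hv' : 0 < fderiv ℝ (fun y => -r y) y v := by
      have h2 := congrArg (fun L : Eucl n →L[ℝ] ℝ => L v) hD
      simp only [add_apply, zero_apply] at h2
      rw [fderiv_fun_neg, neg_apply]
      linarith
    have h2 := exists_pos_on_segment (h := fun y => -r y) hdr.neg (by simp [hy0.2]) hv'
    obtain ⟨t, ht1, ht2⟩ := (h1.and h2).exists
    by_cases hA : y + t • v ∈ A
    · have := hr.nonneg _ hA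
      linarith
    · have := hh.nonpos _ hA
      linarith

lemma isSignAdapted_sum {ι : Type*} (s : Finset ι) {f : ι → Eucl n → ℝ}
    (hf : ∀ i ∈ s, IsSignAdapted A (f i)) : IsSignAdapted A (fun y => ∑ i ∈ s, f i y) where
  contDiff := ContDiff.sum fun i hi => (hf i hi).contDiff
  nonneg y hy := Finset.sum_nonneg fun i hi => (hf i hi).nonneg y hy
  nonpos y hy := Finset.sum_nonpos fun i hi => (hf i hi).nonpos y hy

lemma regularSet_subset_sum {ι : Type*} [DecidableEq ι] {s : Finset ι} {f : ι → Eucl n → ℝ}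
    (hf : ∀ i ∈ s, IsSignAdapted A (f i)) {i : ι} (hi : i ∈ s) :
    regularSet (f i) ⊆ regularSet (fun y => ∑ i ∈ s, f i y) := by
  have h1 := (hf i hi).regularSet_subset_add
    (isSignAdapted_sum (s.erase i) fun j hj => hf j (Finset.mem_of_mem_erase hj))
  have h2 : (fun y => f i y + ∑ j ∈ s.erase i, f j y) = fun y => ∑ j ∈ s, f j y :=
    funext fun y => Finset.add_sum_erase s (fun j => f j y) hi
  rwa [h2] at h1

/-- A bump inside `G`, a negative bump inside the exterior, and at a boundary point minus a bump
times the local defining function, which is negative on `G`. -/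
lemma exists_signAdapted_near {G : Set (Torus n)} (hG : IsOpen G) (hb : HasSmoothBoundary G)
    (x : Eucl n) : ∃ h : Eucl n → ℝ,
      IsSignAdapted ((fun y : Eucl n => (y : Torus n)) ⁻¹' G) h ∧ HasCompactSupport h ∧
        x ∈ regularSet h := by
  have bump : ∀ U : Set (Eucl n), IsOpen U → x ∈ U →
      ∃ b : ContDiffBump x, Metric.ball x b.rOut ⊆ U :=
    fun U hU hx => by
      obtain ⟨ε, hε, hεU⟩ := Metric.isOpen_iff.1 hU x hx
      exact ⟨⟨ε / 2, ε, half_pos hε, half_lt_self hε⟩, hεU⟩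
  have hb0 : ∀ (b : ContDiffBump x) (y), y ∉ Metric.ball x b.rOut → b y = 0 := fun b y hy =>
    b.zero_of_le_dist (not_lt.1 hy)
  have hb1 : ∀ b : ContDiffBump x, b x = 1 := fun b =>
    b.one_of_mem_closedBall (Metric.mem_closedBall_self b.rIn_pos.le)
  by_cases hx : (x : Torus n) ∈ G
  · obtain ⟨b, hbU⟩ := bump _ (hG.preimage continuous_torusMk) hx
    refine ⟨b, ⟨b.contDiff, fun y _ => b.nonneg, fun y hy => ?_⟩, b.hasCompactSupport, ?_⟩
    · exact (hb0 b y fun h => hy (hbU h)).le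
    · exact Or.inl (by rw [hb1]; exact one_ne_zero)
  by_cases hx' : (x : Torus n) ∈ interior Gᶜ
  · obtain ⟨b, hbU⟩ := bump _ (isOpen_interior.preimage continuous_torusMk) hx'
    refine ⟨fun y => -b y, ⟨b.contDiff.neg, fun y hy => ?_, fun y hy => ?_⟩,
      b.hasCompactSupport.neg, ?_⟩
    · rw [hb0 b y fun h => interior_subset (hbU h) hy, neg_zero]
    · exact neg_nonpos.2 b.nonneg
    · exact Or.inl (by simp [hb1])
  · have hfr : (x : Torus n) ∈ frontier G := by
      rw [interior_compl, mem_compl_iff, not_not] at hx'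
      exact ⟨hx', by rwa [hG.interior_eq]⟩
    obtain ⟨ρ, hρ, f, hf, hf0, hfG⟩ := hb _ hfr
    let b : ContDiffBump x := ⟨ρ / 4, ρ / 2, by linarith, by linarith⟩
    have hsub : ContDiff ℝ ∞ fun y : Eucl n => y - x := contDiff_id.sub contDiff_const
    have hfat : ∀ y ∈ Metric.ball x ρ, ContDiffAt ℝ ∞ (fun y => f (y - x)) y := fun y hy => by
      have h1 : y - x ∈ Metric.ball 0 ρ := by simpa [dist_eq_norm] using hy
      exact (hf.contDiffAt (Metric.isOpen_ball.mem_nhds h1)).comp y hsub.contDiffAt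
    have hmem : ∀ y ∈ Metric.ball x b.rOut, ((y : Torus n) ∈ G ↔ f (y - x) < 0) := fun y hy => by
      have h1 : y - x ∈ Metric.ball 0 ρ := by
        have h2 : dist y x < ρ / 2 := hy
        rw [mem_ball_zero_iff, ← dist_eq_norm]
        linarith
      have h3 := hfG (y - x) h1
      rwa [← QuotientAddGroup.mk_add, add_sub_cancel] at h3
    have hzero : ∀ y ∉ Metric.ball x b.rOut, -(b y * f (y - x)) = 0 := fun y hy => by
      rw [hb0 b y hy, zero_mul, neg_zero]
    refine ⟨fun y => -(b y * f (y - x)), ⟨?_, fun y hy => ?_, fun y hy => ?_⟩, ?_, ?_⟩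
    · rw [contDiff_iff_contDiffAt]
      intro y
      by_cases hy : y ∈ Metric.ball x ρ
      · exact (b.contDiffAt.mul (hfat y hy)).neg
      · refine (contDiffAt_const (c := (0 : ℝ))).congr_of_eventuallyEq ?_
        have h1 : y ∈ (Metric.closedBall x (ρ / 2))ᶜ := by
          have h2 : ρ ≤ dist y x := not_lt.1 hy
          rw [mem_compl_iff, Metric.mem_closedBall, not_le]
          linarith
        filter_upwards [Metric.isClosed_closedBall.isOpen_compl.mem_nhds h1] with w hw
        exact hzero w fun h => hw (Metric.ball_subset_closedBall h)
    · by_cases hyb : y ∈ Metric.ball x b.rOut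
      · exact neg_nonneg.2 (mul_nonpos_of_nonneg_of_nonpos b.nonneg ((hmem y hyb).1 hy).le)
      · exact (hzero y hyb).ge
    · by_cases hyb : y ∈ Metric.ball x b.rOut
      · exact neg_nonpos.2 (mul_nonneg b.nonneg (not_lt.1 fun h => hy ((hmem y hyb).2 h)))
      · exact (hzero y hyb).le
    · exact (b.hasCompactSupport.mul_right (f' := fun y => f (y - x))).neg
    · by_cases h0 : f 0 = 0
      · right
        have h1 : HasFDerivAt f (fderiv ℝ f 0) (x - x) := by
          rw [sub_self]
          exact ((hf.contDiffAt (Metric.isOpen_ball.mem_nhds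
            (Metric.mem_ball_self hρ))).differentiableAt (by simp)).hasFDerivAt
        have h2 := ((b.contDiffAt (n := 1) (x := x)).differentiableAt one_ne_zero).hasFDerivAt
        have h3 := (h2.mul ((hasFDerivAt_comp_sub x).2 h1)).neg
        have h4 : HasFDerivAt (fun y => -(b y * f (y - x))) (-fderiv ℝ f 0) x := by
          have h5 := h3.congr_fderiv (g' := -fderiv ℝ f 0) (by simp [h0, hb1])
          exact h5
        rw [h4.fderiv]
        exact neg_ne_zero.2 hf0
      · left
        simpa [hb1] using h0

lemma locallyFinite_support_translates (hs : HasCompactSupport h) :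
    LocallyFinite fun k : intLattice n => Function.support fun y => h (y + k) := by
  intro y
  refine ⟨Metric.ball y 1, Metric.ball_mem_nhds y one_pos, ?_⟩
  obtain ⟨R, hR⟩ := hs.isCompact.isBounded.exists_norm_le
  have h1 := (ZSpan.setFinite_inter (EuclideanSpace.basisFun (Fin n) ℝ).toBasis
    (Metric.isBounded_closedBall (x := (0 : Eucl n)) (r := R + (‖y‖ + 1)))).preimage
      (Subtype.val_injective (p := (· ∈ intLattice n))).injOn
  refine h1.subset fun k hk => ⟨?_, k.2⟩
  obtain ⟨w, hw, hwb⟩ := hk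
  have h2 : ‖w + k‖ ≤ R := hR _ (subset_tsupport _ hw)
  have h3 : ‖w‖ ≤ ‖y‖ + 1 := by
    have h4 : ‖w - y‖ < 1 := by rwa [← dist_eq_norm]
    linarith [norm_sub_norm_le w y]
  rw [mem_closedBall_zero_iff]
  calc ‖(k : Eucl n)‖ = ‖(w + k) - w‖ := by rw [add_sub_cancel_left]
    _ ≤ ‖w + k‖ + ‖w‖ := norm_sub_le _ _
    _ ≤ R + (‖y‖ + 1) := add_le_add h2 h3

/-- Sum the lattice translates. Every point has a translate in the cube, where the corresponding
term is regular, and adding sign-adapted functions preserves regularity. -/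
lemma exists_periodic_signAdapted (hA : ∀ y, ∀ k ∈ intLattice n, y + k ∈ A ↔ y ∈ A)
    (hh : IsSignAdapted A h) (hs : HasCompactSupport h) (hcube : unitCube n ⊆ regularSet h) :
    ∃ F : Eucl n → ℝ, IsSignAdapted A F ∧ IsLatticePeriodic F ∧ ∀ y, y ∈ regularSet F := by
  have hloc := locallyFinite_support_translates hs
  have hfin : ∀ y, (Function.support fun k : intLattice n => h (y + k)).Finite := fun y =>
    hloc.point_finite y
  have hk : ∀ k : intLattice n, IsSignAdapted A fun y => h (y + k) := fun k =>
    ⟨hh.contDiff.comp (contDiff_id.add contDiff_const),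
      fun y hy => hh.nonneg _ ((hA y k k.2).2 hy),
      fun y hy => hh.nonpos _ fun h' => hy ((hA y k k.2).1 h')⟩
  have hF : IsSignAdapted A fun y => ∑ᶠ k : intLattice n, h (y + k) := by
    refine ⟨?_, fun y hy => finsum_nonneg fun k => (hk k).nonneg y hy, fun y hy => ?_⟩
    · rw [← contMDiff_iff_contDiff]
      exact contMDiff_finsum (fun k => (hk k).contDiff.contMDiff) hloc
    · have := finsum_nonneg fun k => neg_nonneg.2 ((hk k).nonpos y hy)
      rw [finsum_neg_distrib] at this
      linarith
  refine ⟨_, hF, fun y k₀ hk₀ => ?_, fun y => ?_⟩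
  · change ∑ᶠ k : intLattice n, h (y + k₀ + k) = ∑ᶠ k : intLattice n, h (y + k)
    rw [← finsum_comp_equiv (Equiv.addLeft (⟨k₀, hk₀⟩ : intLattice n))
      (f := fun k : intLattice n => h (y + k))]
    simp [add_assoc]
  · obtain ⟨k, hkL, hky⟩ := exists_add_mem_unitCube y
    -- The remaining terms have a common sign at each point, so removing one term leaves a
    -- sign-adapted function.
    have hr : IsSignAdapted A fun y => (∑ᶠ k : intLattice n, h (y + k)) - h (y + k) := by
      refine ⟨hF.contDiff.sub (hk ⟨k, hkL⟩).contDiff, fun y hy => ?_, fun y hy => ?_⟩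
      · exact sub_nonneg.2 (single_le_finsum (⟨k, hkL⟩ : intLattice n) (hfin y)
          fun k => (hk k).nonneg y hy)
      · have h1 := single_le_finsum (⟨k, hkL⟩ : intLattice n)
          (f := fun k : intLattice n => -h (y + k))
          (by simpa [Function.HasFiniteSupport] using hfin y)
          fun k => neg_nonneg.2 ((hk k).nonpos y hy)
        rw [finsum_neg_distrib] at h1
        exact sub_nonpos.2 (neg_le_neg_iff.1 h1)
    have h1 := (hk ⟨k, hkL⟩).regularSet_subset_add hr
    simp only [add_sub_cancel] at h1
    refine h1 ?_
    have h2 := hcube hky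
    simpa only [regularSet, mem_ofPred_eq, fderiv_comp_add_right] using h2

/-- An open subset of the torus with smooth boundary is the positivity set of a smooth function
without critical zeros. -/
lemma exists_definingFunction {G : Set (Torus n)} (hG : IsOpen G) (hb : HasSmoothBoundary G) :
    ∃ F : Eucl n → ℝ, ContDiff ℝ ∞ F ∧ IsLatticePeriodic F ∧
      (∀ y : Eucl n, 0 < F y ↔ (y : Torus n) ∈ G) ∧ ∀ y, F y = 0 → fderiv ℝ F y ≠ 0 := by
  classical
  set A := (fun y : Eucl n => (y : Torus n)) ⁻¹' G with hAdef
  choose f hf hfs hfx using exists_signAdapted_near hG hb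
  obtain ⟨t, ht⟩ := isBounded_unitCube.isCompact_closure.elim_finite_subcover
    (fun x : Eucl n => regularSet (f x)) (fun x => isOpen_regularSet (hf x).contDiff)
    fun x _ => mem_iUnion.2 ⟨x, hfx x⟩
  have hcube : unitCube n ⊆ regularSet fun y => ∑ x ∈ t, f x y := fun y hy => by
    obtain ⟨x, hx, hyx⟩ := mem_iUnion₂.1 (ht (subset_closure hy))
    exact regularSet_subset_sum (fun i _ => hf i) hx hyx
  have hs : HasCompactSupport fun y => ∑ x ∈ t, f x y := by
    have := HasCompactSupport.finset_sum (s := t) (f := f) fun i _ => hfs i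
    rwa [show ∑ i ∈ t, f i = fun y => ∑ x ∈ t, f x y from
      funext fun y => Finset.sum_apply y t f] at this
  have hA : ∀ y, ∀ k ∈ intLattice n, y + k ∈ A ↔ y ∈ A := fun y k hk =>
    iff_of_eq (isLatticePeriodic_lift (fun x => x ∈ G) y k hk)
  obtain ⟨F, hF, hFp, hreg⟩ := exists_periodic_signAdapted hA
    (isSignAdapted_sum t fun i _ => hf i) hs hcube
  have h0 : ∀ y, F y = 0 → fderiv ℝ F y ≠ 0 := fun y hy => (hreg y).resolve_left fun h => h hy
  refine ⟨F, hF.contDiff, hFp, fun y => ⟨fun hy => ?_, fun hy => ?_⟩, h0⟩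
  · by_contra hyG
    exact (hF.nonpos y hyG).not_gt hy
  -- A zero inside the open set would be a local minimum, hence a critical zero.
  · refine lt_of_le_of_ne (hF.nonneg y hy) fun hy0 => h0 y hy0.symm ?_
    have hmin : IsLocalMin F y := by
      filter_upwards [(hG.preimage continuous_torusMk).mem_nhds hy] with w hw
      rw [← hy0]
      exact hF.nonneg w hw
    exact hmin.fderiv_eq_zero

end DefiningFunction

/-! ### The gradient of the anisotropy and the calibrating field. -/

section Anisotropy

open scoped RealInnerProductSpace

variable {W : Eucl n → ℝ}

lemma IsAnisotropy.nonneg (hW : IsAnisotropy W) (p : Eucl n) : 0 ≤ W p := by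
  obtain ⟨lam, h0, h⟩ := hW.coercive
  exact (mul_nonneg h0.le (norm_nonneg p)).trans (h p)

lemma IsAnisotropy.map_zero (hW : IsAnisotropy W) : W 0 = 0 := by
  simpa using hW.homogeneous 0 0 le_rfl

lemma IsAnisotropy.add_le (hW : IsAnisotropy W) (p q : Eucl n) : W (p + q) ≤ W p + W q := by
  obtain ⟨-, h⟩ := hW.convexOn
  have hhalf : (0 : ℝ) ≤ 1 / 2 := by norm_num
  have h1 := h (mem_univ p) (mem_univ q) hhalf hhalf (by norm_num)
  rw [← smul_add, hW.homogeneous _ _ (by norm_num)] at h1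
  simp only [smul_eq_mul] at h1
  linarith

lemma IsAnisotropy.contDiffAt (hW : IsAnisotropy W) {q : Eucl n} (hq : q ≠ 0) :
    ContDiffAt ℝ 2 W q :=
  hW.contDiffOn.contDiffAt (isOpen_compl_singleton.mem_nhds hq)

lemma IsAnisotropy.hasDerivAt_line (hW : IsAnisotropy W) {q : Eucl n} (hq : q ≠ 0) (p : Eucl n) :
    HasDerivAt (fun t : ℝ => W (q + t • p)) ⟪gradient W q, p⟫ 0 := by
  rw [gradient, InnerProductSpace.toDual_symm_apply]
  exact ((hW.contDiffAt hq).differentiableAt (by norm_num)).hasFDerivAt.hasLineDerivAt p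

/-- Euler's identity for degree one. -/
lemma IsAnisotropy.inner_gradient_self (hW : IsAnisotropy W) {q : Eucl n} (hq : q ≠ 0) :
    ⟪gradient W q, q⟫ = W q := by
  have h1 : HasDerivAt (fun t : ℝ => (1 + t) * W q) (1 * W q) 0 :=
    ((hasDerivAt_id (0 : ℝ)).const_add 1).mul_const (W q)
  have h2 : (fun t : ℝ => W (q + t • q)) =ᶠ[𝓝 0] fun t => (1 + t) * W q := by
    filter_upwards [lt_mem_nhds (show (-1 : ℝ) < 0 by norm_num)] with t ht
    rw [← hW.homogeneous _ _ (by linarith), add_smul, one_smul]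
  rw [(hW.hasDerivAt_line hq q).unique (h1.congr_of_eventuallyEq h2), one_mul]

/-- By subadditivity and homogeneity, the difference quotients of `W` at `q` in the direction `p`
are at most `W p`. -/
lemma IsAnisotropy.inner_gradient_le (hW : IsAnisotropy W) {q : Eucl n} (hq : q ≠ 0)
    (p : Eucl n) : ⟪gradient W q, p⟫ ≤ W p := by
  have h2 := (hasDerivWithinAt_iff_tendsto_slope' self_notMem_Ioi).1
    ((hW.hasDerivAt_line hq p).hasDerivWithinAt (s := Ioi 0))
  refine le_of_tendsto h2 ?_
  filter_upwards [self_mem_nhdsWithin] with t ht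
  have ht0 : 0 < t := ht
  have h3 := hW.add_le q (t • p)
  rw [hW.homogeneous _ _ ht0.le] at h3
  simp only [slope, sub_zero, zero_smul, add_zero, vsub_eq_sub, smul_eq_mul]
  rw [inv_mul_le_iff₀ ht0]
  linarith

lemma IsAnisotropy.contDiffAt_gradient (hW : IsAnisotropy W) {q : Eucl n} (hq : q ≠ 0) :
    ContDiffAt ℝ 1 (gradient W) q :=
  (InnerProductSpace.toDual ℝ (Eucl n)).symm.contDiff.contDiffAt.comp q
    ((hW.contDiffAt hq).fderiv_right (by norm_num))

/-- The bump function that localizes the calibrating field near the zero set of a function. -/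
def levelCutoff : ContDiffBump (0 : ℝ) := ⟨1 / 2, 3 / 4, by norm_num, by norm_num⟩

/-- The field `∇W(∇F)`, cut off away from the zero set of `F`. -/
def calibratingField (W : Eucl n → ℝ) (F : Eucl n → ℝ) (y : Eucl n) : Eucl n :=
  levelCutoff (F y) • gradient W (gradient F y)

variable {F : Eucl n → ℝ}

lemma calibratingField_eq_zero {y : Eucl n} (hy : 3 / 4 ≤ |F y|) :
    calibratingField W F y = 0 := by
  have h : levelCutoff.rOut ≤ dist (F y) 0 := by
    rw [Real.dist_eq, sub_zero]
    exact hy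
  rw [calibratingField, levelCutoff.zero_of_le_dist h, zero_smul]

lemma gradient_ne_zero {y : Eucl n} (h : fderiv ℝ F y ≠ 0) : gradient F y ≠ 0 := by
  rw [gradient]
  simpa using h

lemma isLatticePeriodic_calibratingField (hF : IsLatticePeriodic F) :
    IsLatticePeriodic (calibratingField W F) := by
  intro y k hk
  rw [calibratingField, calibratingField, hF y k hk, hF.gradient y k hk]

/-- Where `|F| < 1` the gradient of `F` avoids the singularity of `W` at `0`; where `|F| > 3/4` the
field vanishes. These two open sets cover the space. -/
lemma contDiff_calibratingField (hW : IsAnisotropy W) (hF : ContDiff ℝ ∞ F)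
    (hreg : ∀ y, |F y| < 1 → fderiv ℝ F y ≠ 0) : ContDiff ℝ 1 (calibratingField W F) := by
  rw [contDiff_iff_contDiffAt]
  intro y
  by_cases hy : |F y| < 1
  · have h1 : ContDiffAt ℝ 1 (gradient F) y :=
      (InnerProductSpace.toDual ℝ (Eucl n)).symm.contDiff.contDiffAt.comp y
        ((contDiff_infty_iff_fderiv.1 hF).2.of_le (by exact_mod_cast le_top)).contDiffAt
    have h2 : ContDiffAt ℝ 1 (fun y => gradient W (gradient F y)) y :=
      (hW.contDiffAt_gradient (gradient_ne_zero (hreg y hy))).comp y h1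
    have h3 : ContDiffAt ℝ 1 (fun y => levelCutoff (F y)) y :=
      levelCutoff.contDiff.contDiffAt.comp y (hF.contDiffAt.of_le (by exact_mod_cast le_top))
    exact h3.smul h2
  · refine (contDiffAt_const (c := (0 : Eucl n))).congr_of_eventuallyEq ?_
    have h1 : 3 / 4 < |F y| := by linarith
    filter_upwards [hF.continuous.abs.continuousAt.eventually (lt_mem_nhds h1)] with w hw
    exact calibratingField_eq_zero hw.le

lemma inner_calibratingField_le (hW : IsAnisotropy W)
    (hreg : ∀ y, |F y| < 1 → fderiv ℝ F y ≠ 0) (y p : Eucl n) :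
    ⟪calibratingField W F y, p⟫ ≤ W p := by
  by_cases hy : |F y| < 1
  · rw [calibratingField, real_inner_smul_left]
    have h1 := hW.inner_gradient_le (gradient_ne_zero (hreg y hy)) p
    calc levelCutoff (F y) * ⟪gradient W (gradient F y), p⟫ ≤ levelCutoff (F y) * W p :=
          mul_le_mul_of_nonneg_left h1 levelCutoff.nonneg
      _ ≤ 1 * W p := mul_le_mul_of_nonneg_right levelCutoff.le_one (hW.nonneg p)
      _ = W p := one_mul _
  · rw [calibratingField_eq_zero (by linarith), inner_zero_left]
    exact hW.nonneg p

/-- The coefficient `c` will be a derivative of `profile`, which is zero outside the region where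
the cutoff equals `1`. -/
lemma inner_calibratingField_smul_gradient (hW : IsAnisotropy W)
    (hreg : ∀ y, |F y| < 1 → fderiv ℝ F y ≠ 0) {y : Eucl n} {c : ℝ} (hc : 0 ≤ c)
    (hcF : 1 / 2 < |F y| → c = 0) :
    ⟪calibratingField W F y, c • gradient F y⟫ = W (c • gradient F y) := by
  by_cases hy : 1 / 2 < |F y|
  · rw [hcF hy, zero_smul, inner_zero_right, hW.map_zero]
  · have h1 : levelCutoff (F y) = 1 := levelCutoff.one_of_mem_closedBall (by
      rw [Metric.mem_closedBall, Real.dist_eq, sub_zero]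
      exact not_lt.1 hy)
    rw [calibratingField, h1, one_smul, real_inner_smul_right, hW.homogeneous _ _ hc,
      hW.inner_gradient_self (gradient_ne_zero (hreg y (by linarith)))]

end Anisotropy

/-! ### Normalized defining functions and the profile. -/

section SupportFunction

open scoped RealInnerProductSpace

lemma exists_pos_le_of_isLatticePeriodic {f : Eucl n → ℝ} (hf : IsLatticePeriodic f)
    (hc : Continuous f) (hpos : ∀ y, 0 < f y) : ∃ ε, 0 < ε ∧ ∀ y, ε ≤ f y := by
  obtain ⟨ε, ⟨y, rfl⟩, hε⟩ := (isCompact_range_of_isLatticePeriodic hf hc).exists_isLeast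
    (range_nonempty f)
  exact ⟨f y, hpos y, fun w => hε ⟨w, rfl⟩⟩

/-- The periodic continuous function `|F| + ‖fderiv ℝ F‖` is positive, so it has a positive minimum.
-/
lemma exists_level_regular {F : Eucl n → ℝ} (hF : ContDiff ℝ ∞ F) (hp : IsLatticePeriodic F)
    (h0 : ∀ y, F y = 0 → fderiv ℝ F y ≠ 0) :
    ∃ ε, 0 < ε ∧ ∀ y, |F y| < ε → fderiv ℝ F y ≠ 0 := by
  have hc : Continuous fun y => |F y| + ‖fderiv ℝ F y‖ :=
    hF.continuous.abs.add (hF.continuous_fderiv (by simp)).norm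
  have hper : IsLatticePeriodic fun y => |F y| + ‖fderiv ℝ F y‖ := fun y k hk => by
    simp only [hp y k hk, hp.fderiv y k hk]
  obtain ⟨ε, hε, h⟩ := exists_pos_le_of_isLatticePeriodic hper hc fun y => by
    by_cases hy : F y = 0
    · exact add_pos_of_nonneg_of_pos (abs_nonneg _) (norm_pos_iff.2 (h0 y hy))
    · exact add_pos_of_pos_of_nonneg (abs_pos.2 hy) (norm_nonneg _)
  refine ⟨ε, hε, fun y hy hd => ?_⟩
  have := h y
  rw [hd, norm_zero, add_zero] at this
  linarith

/-- Off the closure `F ≤ 0` nearby, so a zero there would be a local maximum, hence critical. -/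
lemma mem_closure_of_definingFunction_nonneg {G : Set (Torus n)} {F : Eucl n → ℝ}
    (hG : ∀ y : Eucl n, 0 < F y ↔ (y : Torus n) ∈ G) (h0 : ∀ y, F y = 0 → fderiv ℝ F y ≠ 0)
    {y : Eucl n} (hy : 0 ≤ F y) : (y : Torus n) ∈ closure G := by
  by_contra hcl
  have hev : ∀ᶠ w in 𝓝 y, F w ≤ 0 := by
    filter_upwards [(isClosed_closure.isOpen_compl.preimage continuous_torusMk).mem_nhds hcl]
      with w hw
    exact not_lt.1 fun h => hw (subset_closure ((hG w).1 h))
  have hy0 : F y = 0 := le_antisymm hev.self_of_nhds hy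
  have hmax : IsLocalMax F y := by
    filter_upwards [hev] with w hw
    rwa [hy0]
  exact h0 y hy0 hmax.fderiv_eq_zero

lemma IsSmoothPair.disjoint_closure {A B : Set (Torus n)} (h : IsSmoothPair A B) :
    Disjoint (closure A) (closure B) := by
  rw [Set.disjoint_left]
  intro x hA hB
  have hpos := ENNReal.half_pos h.dist_pos.ne'
  obtain ⟨a, ha, hxa⟩ := EMetric.mem_closure_iff.1 hA _ hpos
  obtain ⟨b, hb, hxb⟩ := EMetric.mem_closure_iff.1 hB _ hpos
  have h1 : (⨅ (x ∈ A) (y ∈ B), edist x y) ≤ edist a b :=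
    (iInf₂_le a ha).trans (iInf₂_le b hb)
  have h2 : edist a b < ⨅ (x ∈ A) (y ∈ B), edist x y := by
    calc edist a b ≤ edist a x + edist x b := edist_triangle _ _ _
      _ < _ := by
        rw [edist_comm a x]
        exact ENNReal.add_lt_add hxa hxb
      _ = _ := ENNReal.add_halves _
  exact h1.not_gt h2

/-- The last clause separates the bands `|P| < 1` and `|Q| < 1`. It comes from disjointness of the
closures: the defining functions of the two sets are nowhere both nonnegative, so by compactness one
of them is always below a fixed negative level. -/
lemma exists_normalized_definingFunctions {A B : Set (Torus n)} (h : IsSmoothPair A B) :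
    ∃ P Q : Eucl n → ℝ, ContDiff ℝ ∞ P ∧ ContDiff ℝ ∞ Q ∧ IsLatticePeriodic P ∧
      IsLatticePeriodic Q ∧ (∀ y : Eucl n, 0 < P y ↔ (y : Torus n) ∈ B) ∧
      (∀ y : Eucl n, Q y < 0 ↔ (y : Torus n) ∈ A) ∧
      (∀ y, |P y| < 1 → fderiv ℝ P y ≠ 0) ∧ (∀ y, |Q y| < 1 → fderiv ℝ Q y ≠ 0) ∧
      ∀ y, P y ≤ -1 ∨ 1 ≤ Q y := by
  obtain ⟨F, hF, hFp, hFB, hF0⟩ := exists_definingFunction h.isOpen_plus h.smooth_plus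
  obtain ⟨G, hG, hGp, hGA, hG0⟩ := exists_definingFunction h.isOpen_minus h.smooth_minus
  obtain ⟨ε₁, hε₁, h₁⟩ := exists_level_regular hF hFp hF0
  obtain ⟨ε₂, hε₂, h₂⟩ := exists_level_regular hG hGp hG0
  obtain ⟨ε₃, hε₃, h₃⟩ := exists_pos_le_of_isLatticePeriodic
    (f := fun y => max (-F y) (-G y)) (fun y k hk => by simp only [hFp y k hk, hGp y k hk])
    (hF.continuous.neg.max hG.continuous.neg) (fun y => by
      by_contra hcon
      have h4 : -F y ≤ 0 ∧ -G y ≤ 0 := max_le_iff.1 (not_lt.1 hcon)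
      exact Set.disjoint_left.1 h.disjoint_closure
        (mem_closure_of_definingFunction_nonneg hGA hG0 (neg_nonpos.1 h4.2))
        (mem_closure_of_definingFunction_nonneg hFB hF0 (neg_nonpos.1 h4.1)))
  -- One scaling factor brings all three thresholds to level `1`.
  obtain ⟨c, hc, hc₁, hc₂, hc₃⟩ : ∃ c : ℝ, 0 < c ∧ 1 ≤ c * ε₁ ∧ 1 ≤ c * ε₂ ∧ 1 ≤ c * ε₃ := by
    refine ⟨ε₁⁻¹ + ε₂⁻¹ + ε₃⁻¹, by positivity, ?_, ?_, ?_⟩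
    all_goals
      field_simp
      nlinarith [mul_pos hε₁ hε₂, mul_pos hε₁ hε₃, mul_pos hε₂ hε₃]
  have hscale : ∀ {f : Eucl n → ℝ} {a : ℝ} {ε : ℝ}, a ≠ 0 → |a| = c → 1 ≤ c * ε →
      ContDiff ℝ ∞ f → (∀ y, |f y| < ε → fderiv ℝ f y ≠ 0) →
      ∀ y, |a * f y| < 1 → fderiv ℝ (fun y => a * f y) y ≠ 0 := by
    intro f a ε ha hac hcε hf hreg y hy
    rw [fderiv_const_mul (hf.differentiable (by simp) y)]
    refine smul_ne_zero ha (hreg y ?_)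
    rw [abs_mul, hac] at hy
    exact lt_of_mul_lt_mul_left (hy.trans_le hcε) hc.le
  refine ⟨fun y => c * F y, fun y => -c * G y, contDiff_const.mul hF, contDiff_const.mul hG,
    hFp.comp (c * ·), hGp.comp (-c * ·), fun y => ?_, fun y => ?_,
    hscale hc.ne' (abs_of_pos hc) hc₁ hF h₁,
    hscale (neg_ne_zero.2 hc.ne') (by rw [abs_neg, abs_of_pos hc]) hc₂ hG h₂, fun y => ?_⟩
  · rw [mul_pos_iff_of_pos_left hc, hFB]
  · change -c * G y < 0 ↔ _
    rw [neg_mul, neg_lt_zero, mul_pos_iff_of_pos_left hc, hGA]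
  · rcases le_max_iff.1 (h₃ y) with h4 | h4
    · left
      have := mul_le_mul_of_nonneg_left h4 hc.le
      linarith
    · right
      have := mul_le_mul_of_nonneg_left h4 hc.le
      linarith

/-- A smooth monotone profile, vanishing on `(-∞, 0]` and constant on `[1/2, ∞)`. -/
def profile (t : ℝ) : ℝ := Real.smoothTransition (2 * t)

lemma contDiff_profile : ContDiff ℝ ∞ profile :=
  Real.smoothTransition.contDiff.comp (contDiff_const.mul contDiff_id)

lemma profile_pos {t : ℝ} (ht : 0 < t) : 0 < profile t :=
  Real.smoothTransition.pos_of_pos (by linarith)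

lemma profile_eq_zero {t : ℝ} (ht : t ≤ 0) : profile t = 0 :=
  Real.smoothTransition.zero_of_nonpos (by linarith)

lemma deriv_profile_nonneg (t : ℝ) : 0 ≤ deriv profile t :=
  Monotone.deriv_nonneg (Real.smoothTransition.monotone.comp
    (monotone_id.const_mul (by norm_num : (0 : ℝ) ≤ 2)))

lemma deriv_profile_eq_zero {t : ℝ} (ht : 1 / 2 < |t|) : deriv profile t = 0 := by
  rcases lt_abs.1 ht with h | h
  · have : profile =ᶠ[𝓝 t] fun _ => 1 := by
      filter_upwards [lt_mem_nhds h] with s hs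
      exact Real.smoothTransition.one_of_one_le (by linarith)
    rw [this.deriv_eq, deriv_const]
  · have : profile =ᶠ[𝓝 t] fun _ => 0 := by
      filter_upwards [gt_mem_nhds (show t < 0 by linarith)] with s hs
      exact profile_eq_zero (by linarith)
    rw [this.deriv_eq, deriv_const]

/-- The quotient distance is an infimum over lifts, so the mean value inequality on `ℝⁿ` along a
nearly shortest lift suffices. -/
lemma IsSmooth.exists_lipschitzWith {ψ : Torus n → ℝ} (hψ : IsSmooth ψ) :
    ∃ K, LipschitzWith K ψ := by
  have hd : ContDiff ℝ ∞ fun y : Eucl n => ψ (y : Torus n) := hψ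
  obtain ⟨C, hC⟩ := exists_norm_le_of_isLatticePeriodic (isLatticePeriodic_lift ψ).fderiv
    (hd.continuous_fderiv (by simp))
  have hC0 : 0 ≤ C := (norm_nonneg _).trans (hC 0)
  refine ⟨⟨C, hC0⟩, LipschitzWith.of_dist_le_mul fun a b => ?_⟩
  refine le_of_forall_pos_le_add fun ε hε => ?_
  obtain ⟨y, rfl⟩ := QuotientAddGroup.mk_surjective b
  obtain ⟨m, hm, hlt⟩ := QuotientAddGroup.exists_norm_mk_lt (a - (y : Torus n))
    (show 0 < ε / (C + 1) by positivity)
  have ha : a = ((y + m : Eucl n) : Torus n) := by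
    rw [QuotientAddGroup.mk_add, hm, add_sub_cancel]
  have h1 := Convex.norm_image_sub_le_of_norm_fderiv_le (𝕜 := ℝ)
    (f := fun y : Eucl n => ψ (y : Torus n)) (fun x _ => hd.differentiable (by simp) x)
    (fun x _ => hC x) convex_univ (mem_univ y) (mem_univ (y + m))
  rw [add_sub_cancel_left] at h1
  rw [dist_eq_norm, dist_eq_norm]
  change ‖ψ a - ψ (y : Torus n)‖ ≤ C * ‖a - (y : Torus n)‖ + ε
  rw [← ha] at h1
  calc ‖ψ a - ψ y‖ ≤ C * ‖m‖ := h1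
    _ ≤ C * (‖a - (y : Torus n)‖ + ε / (C + 1)) := mul_le_mul_of_nonneg_left hlt.le hC0
    _ = C * ‖a - (y : Torus n)‖ + ε * (C / (C + 1)) := by ring
    _ ≤ C * ‖a - (y : Torus n)‖ + ε * 1 := by
      gcongr
      rw [div_le_one (by linarith)]
      linarith
    _ = _ := by rw [mul_one]

/-- The two minus signs cancel, so both gradients carry nonnegative coefficients. This matters
because `W` need not be even. -/
lemma gradient_profile_sub_profile {P Q : Eucl n → ℝ} (hP : ContDiff ℝ ∞ P)
    (hQ : ContDiff ℝ ∞ Q) (y : Eucl n) :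
    gradient (fun y => profile (P y) - profile (-Q y)) y =
      deriv profile (P y) • gradient P y + deriv profile (-Q y) • gradient Q y := by
  have hd : Differentiable ℝ profile := contDiff_profile.differentiable (by simp)
  have h1 := (hd (P y)).hasDerivAt.comp_hasFDerivAt y
    (hP.differentiable (by simp) y).hasFDerivAt
  have h2 := (hd (-Q y)).hasDerivAt.comp_hasFDerivAt y
    (hQ.differentiable (by simp) y).hasFDerivAt.neg
  have h3 : HasFDerivAt (fun y => profile (P y) - profile (-Q y)) _ y := h1.sub h2
  simp only [gradient]
  rw [h3.fderiv]
  simp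

end SupportFunction

end TVFlow

end

/-! ### The support function and its calibration. -/

theorem mainTheorem5 (n : ℕ) (hn : 1 ≤ n) (W : TVFlow.Eucl n → ℝ) (hW : TVFlow.IsAnisotropy W)
    (Gminus Gplus : Set (TVFlow.Torus n)) (hG : TVFlow.IsSmoothPair Gminus Gplus) :
    ∃ ψ : TVFlow.Torus n → ℝ, TVFlow.IsSupportFunction ψ Gminus Gplus ∧
      ∃ hψ : MemLp ψ 2 (TVFlow.torusMeasure n),
        hψ.toLp ψ ∈ TVFlow.domSubdifferential (TVFlow.energy W) := by
  obtain ⟨P, Q, hP, hQ, hPp, hQp, hPG, hQG, hPreg, hQreg, hPQ⟩ :=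
    TVFlow.exists_normalized_definingFunctions hG
  have hper : TVFlow.IsLatticePeriodic fun y => TVFlow.profile (P y) - TVFlow.profile (-Q y) :=
    fun y k hk => by simp only [hPp y k hk, hQp y k hk]
  have hsm : ContDiff ℝ ∞ fun y => TVFlow.profile (P y) - TVFlow.profile (-Q y) :=
    (TVFlow.contDiff_profile.comp hP).sub (TVFlow.contDiff_profile.comp hQ.neg)
  have hψ := TVFlow.isSmooth_descend hper hsm
  obtain ⟨C, hC⟩ := TVFlow.exists_norm_le_torus hψ.continuous
  refine ⟨_, ⟨hψ.exists_lipschitzWith, fun x hx => ?_, fun x hx => ?_, fun x hx => ?_⟩,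
    MemLp.of_bound hψ.continuous.aestronglyMeasurable C (Filter.Eventually.of_forall hC),
    TVFlow.mem_domSubdifferential_of_calibration
      (z := fun y => TVFlow.calibratingField W P y + TVFlow.calibratingField W Q y)
      hψ _ hW.nonneg (fun y k hk => ?_)
      ((TVFlow.contDiff_calibratingField hW hP hPreg).add
        (TVFlow.contDiff_calibratingField hW hQ hQreg)) (fun y p => ?_) (fun x => ?_)⟩
  · obtain ⟨y, rfl⟩ := QuotientAddGroup.mk_surjective x
    have h1 := TVFlow.profile_pos ((hPG y).2 hx)
    have h2 : 0 ≤ Q y := not_lt.1 fun h => Set.disjoint_left.1 hG.disjoint ((hQG y).1 h) hx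
    rw [TVFlow.descend_mk hper, TVFlow.profile_eq_zero (neg_nonpos.2 h2), sub_zero]
    exact h1
  · obtain ⟨y, rfl⟩ := QuotientAddGroup.mk_surjective x
    have h1 : P y ≤ 0 := not_lt.1 fun h => hx (Or.inr ((hPG y).1 h))
    have h2 : 0 ≤ Q y := not_lt.1 fun h => hx (Or.inl ((hQG y).1 h))
    rw [TVFlow.descend_mk hper, TVFlow.profile_eq_zero (neg_nonpos.2 h2),
      TVFlow.profile_eq_zero h1, sub_zero]
  · obtain ⟨y, rfl⟩ := QuotientAddGroup.mk_surjective x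
    have h1 : P y ≤ 0 := not_lt.1 fun h => Set.disjoint_left.1 hG.disjoint hx ((hPG y).1 h)
    have h2 := TVFlow.profile_pos (neg_pos.2 ((hQG y).2 hx))
    rw [TVFlow.descend_mk hper, TVFlow.profile_eq_zero h1]
    linarith
  · simp only [TVFlow.isLatticePeriodic_calibratingField hPp y k hk,
      TVFlow.isLatticePeriodic_calibratingField hQp y k hk]
  -- At every point at least one of the two fields is cut off to zero, so the sum stays in the Wulff
  -- shape.
  · rcases hPQ y with h | h
    · rw [TVFlow.calibratingField_eq_zero (F := P) (le_abs.2 (Or.inr (by linarith))), zero_add]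
      exact TVFlow.inner_calibratingField_le hW hQreg y p
    · rw [TVFlow.calibratingField_eq_zero (F := Q) (le_abs.2 (Or.inl (by linarith))), add_zero]
      exact TVFlow.inner_calibratingField_le hW hPreg y p
  · obtain ⟨y, rfl⟩ := QuotientAddGroup.mk_surjective x
    have hzp : TVFlow.IsLatticePeriodic fun y =>
        TVFlow.calibratingField W P y + TVFlow.calibratingField W Q y := fun y k hk => by
      simp only [TVFlow.isLatticePeriodic_calibratingField hPp y k hk,
        TVFlow.isLatticePeriodic_calibratingField hQp y k hk]
    rw [TVFlow.descend_mk hzp, TVFlow.torusGradient_mk]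
    simp only [TVFlow.descend_mk hper]
    rw [TVFlow.gradient_profile_sub_profile hP hQ]
    -- Where one field vanishes, so does the matching term of `∇ψ`, since `profile` is locally
    -- constant there; the other field calibrates what remains.
    rcases hPQ y with h | h
    · have h1 : 3 / 4 ≤ |P y| := le_abs.2 (Or.inr (by linarith))
      rw [TVFlow.calibratingField_eq_zero h1, TVFlow.deriv_profile_eq_zero (by linarith),
        zero_smul, zero_add, zero_add]
      exact TVFlow.inner_calibratingField_smul_gradient hW hQreg (TVFlow.deriv_profile_nonneg _)
        fun h2 => TVFlow.deriv_profile_eq_zero (by rwa [abs_neg])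
    · have h1 : 3 / 4 ≤ |Q y| := le_abs.2 (Or.inl (by linarith))
      rw [TVFlow.calibratingField_eq_zero h1,
        TVFlow.deriv_profile_eq_zero (t := -Q y) (by rw [abs_neg]; linarith),
        zero_smul, add_zero, add_zero]
      exact TVFlow.inner_calibratingField_smul_gradient hW hPreg (TVFlow.deriv_profile_nonneg _)
        fun h2 => TVFlow.deriv_profile_eq_zero h2
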